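/- Let $\mathbf{k}$ be a field and $F\supseteq\mathbf{k}$ a field of finite transcendence degree $n$ over $\mathbf{k}$. Fix a total order on $\mathbb{Z}^n$ respecting addition and a valuation $v:F\setminus\{0\}\to\mathbb{Z}^n$ over $\mathbf{k}$, that is, $v(f+g)\ge\min(v(f),v(g))$, $v(\lambda f)=v(f)$ for $0\ne\lambda\in\mathbf{k}$, and $v(fg)=v(f)+v(g)$, whenever the arguments are non-zero. Assume that $v$ is faithful (takes all values in $\mathbb{Z}^n$) and has one-dimensional leaves (for every $\alpha\in\mathbb Z^n$ the quotient of $\{f: f=0\text{ or }v(f)\ge\alpha\}$ by $\{f: f=0\text{ or }v(f)>\alpha\}$ has dimension at most $1$ over $\mathbf{k}$). For a non-zero polynomial $P=a_dt^d+\cdots+a_0\in F[t]$ with $a_d\neq0$ put $v_t(P)=(v(a_d),d)\in\mathbb{Z}^n\times\mathbb{Z}$. For a non-zero finite-dimensional $\mathbf{k}$-subspace $L\subset F$ let $A_L=\bigoplus_{i\ge0}L^it^i\subset F[t]$, where $L^0=\mathbf{k}$ and $L^i$ is the span of all $i$-fold products of elements of $L$. A graded $\mathbf{k}$-subalgebra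 of $F[t]$ is of integral type if it is a finitely generated module over some $A_L$, and of almost integral type if it is contained in a graded subalgebra of integral type. The Hilbert function of a graded subalgebra $A$ is $H_A(i)=\dim_{\mathbf{k}}A_i\in\mathbb{Z}_{\ge0}\cup\{\infty\}$. Let $S\subset\mathbb{Z}^n\times\mathbb{Z}$ be a semigroup and $\pi:\mathbb{R}^n\times\mathbb{R}\to\mathbb{R}$ the last coordinate. Let $L(S)$ be the real span of $S$, $\mathrm{Con}(S)$ the closure of the set of non-negative real combinations of elements of $S$, $G(S)$ the group generated by $S$, and $\partial M(S)=L(S)\cap\pi^{-1}(0)$. Let $m(S)=[\mathbb{Z}:\pi(G(S))]$, $\mathrm{ind}(S)=[\partial M(S)\cap(\mathbb{Z}^n\times\mathbb{Z}):G(S)\cap\pi^{-1}(0)]$ and $\Delta(S)=\mathrm{Con}(S)\cap\pi^{-1}(m(S))$. The semigroup $S$ is strongly non-negative if $\pi\ge0$ on $S$, $\pi$ is not identically $0$ on $S$, the cone $\mathrm{Con}(S)$ contains no non-zero linear subspace, and $\mathrm{Con}(S)\cap\partial M(S)=\{0\}$. For a convex set $\Delta$ of dimension $q$ whose affine hull $E$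 is parallel to a linear subspace $W$ spanned by integral vectors, $\mathrm{Vol}_q(\Delta)$ denotes the integral volume: the measure of $\Delta$ with respect to the translation-invariant measure on $E$ normalized so that the parallelepiped spanned by a $\mathbb Z$-basis of $W\cap(\mathbb{Z}^n\times\mathbb{Z})$ has measure $1$. **Theorem.** Let $A\subset F[t]$ be a graded subalgebra of almost integral type having a non-zero homogeneous component of positive degree. Let $S(A)=v_t(A\setminus\{0\})$, and put $\Delta(A)=\Delta(S(A))$, $m=m(S(A))$, $\mathrm{ind}(A)=\mathrm{ind}(S(A))$ and $q=\dim\Delta(A)$. Then the semigroup $S(A)$ is strongly non-negative, and $\Delta(A)$ is a convex body (convex, compact and non-empty). Moreover $m$ and $\mathrm{ind}(A)$ are finite, $H_A$ takes only finite values, $\mathrm{Vol}_q(\Delta(A))>0$, and the limit $$\lim_{j\to\infty}\frac{H_A(mj)}{j^q}$$ exists and is equal to $\mathrm{Vol}_q(\Delta(A))/\mathrm{ind}(A)$. In particular, the Hilbert function has polynomial growth of degree $q$ along the multiples of $m$, whether or not $A$ is finitely generated. -/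

import Mathlib

open Polynomial MeasureTheory

noncomputable section

namespace NewtonOkounkov

/-! ### Valuations with values in `ℤⁿ` -/

/-- A valuation `v : F ∖ {0} → ℤⁿ` on a field `F ⊇ k`, where `ℤⁿ` carries some total order
respecting addition. The value `toFun 0` is never used. -/
structure LatticeValuation (k F : Type*) [Field k] [Field F] [Algebra k F] (n : ℕ) where
  /-- the total order on `ℤⁿ` -/
  ord : LinearOrder (Fin n → ℤ)
  /-- the order respects the addition -/
  add_lt_add : ∀ a b c : Fin n → ℤ, ord.lt a b → ord.lt (a + c) (b + c)
  /-- the underlying function, relevant on non-zero elements only -/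
  toFun : F → (Fin n → ℤ)
  /-- `v (f + g) ≥ min (v f, v g)` -/
  map_add : ∀ f g : F, f ≠ 0 → g ≠ 0 → f + g ≠ 0 →
    ord.le (ord.min (toFun f) (toFun g)) (toFun (f + g))
  /-- `v (c f) = v f` for non-zero scalars `c` -/
  map_smul : ∀ (c : k) (f : F), c ≠ 0 → f ≠ 0 → toFun (c • f) = toFun f
  /-- `v (f g) = v f + v g` -/
  map_mul : ∀ f g : F, f ≠ 0 → g ≠ 0 → toFun (f * g) = toFun f + toFun g

namespace LatticeValuation

variable {k F : Type*} [Field k] [Field F] [Algebra k F] {n : ℕ}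

/-- The subspace `F_α = {f | f = 0 or v f ≥ α}`. -/
def subspaceGE (v : LatticeValuation k F n) (α : Fin n → ℤ) : Submodule k F where
  carrier := {f | f = 0 ∨ v.ord.le α (v.toFun f)}
  zero_mem' := Or.inl rfl
  add_mem' := by
    intro f g hf hg
    by_cases hf0 : f = 0
    · simpa [hf0] using hg
    by_cases hg0 : g = 0
    · simpa [hg0] using hf
    by_cases hfg : f + g = 0
    · exact Or.inl hfg
    exact Or.inr (v.ord.le_trans _ _ _
      (@le_min _ v.ord _ _ _ (hf.resolve_left hf0) (hg.resolve_left hg0))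
      (v.map_add f g hf0 hg0 hfg))
  smul_mem' := by
    intro c f hf
    by_cases hc : c = 0
    · exact Or.inl (by simp [hc])
    by_cases hf0 : f = 0
    · exact Or.inl (by simp [hf0])
    refine Or.inr ?_
    rw [v.map_smul c f hc hf0]
    exact hf.resolve_left hf0

/-- The subspace `⋃_{β > α} F_β = {f | f = 0 or v f > α}`. -/
def subspaceGT (v : LatticeValuation k F n) (α : Fin n → ℤ) : Submodule k F where
  carrier := {f | f = 0 ∨ v.ord.lt α (v.toFun f)}
  zero_mem' := Or.inl rfl
  add_mem' := by
    intro f g hf hg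
    by_cases hf0 : f = 0
    · simpa [hf0] using hg
    by_cases hg0 : g = 0
    · simpa [hg0] using hf
    by_cases hfg : f + g = 0
    · exact Or.inl hfg
    exact Or.inr (@lt_of_lt_of_le _ v.ord.toPreorder _ _ _
      (@lt_min _ v.ord _ _ _ (hf.resolve_left hf0) (hg.resolve_left hg0))
      (v.map_add f g hf0 hg0 hfg))
  smul_mem' := by
    intro c f hf
    by_cases hc : c = 0
    · exact Or.inl (by simp [hc])
    by_cases hf0 : f = 0
    · exact Or.inl (by simp [hf0])
    refine Or.inr ?_
    rw [v.map_smul c f hc hf0]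
    exact hf.resolve_left hf0

/-- The leaf `F_α / ⋃_{β > α} F_β` above the point `α`. -/
abbrev Leaf (v : LatticeValuation k F n) (α : Fin n → ℤ) : Type _ :=
  ↥(v.subspaceGE α) ⧸ (v.subspaceGT α).submoduleOf (v.subspaceGE α)

/-- All leaves have dimension at most one. -/
def HasOneDimLeaves (v : LatticeValuation k F n) : Prop :=
  ∀ α : Fin n → ℤ, Module.rank k (v.Leaf α) ≤ 1

/-- The valuation takes all values in `ℤⁿ`. -/
def Faithful (v : LatticeValuation k F n) : Prop :=
  ∀ α : Fin n → ℤ, ∃ f : F, f ≠ 0 ∧ v.toFun f = α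

/-- The valuation `v_t` on `F[t] ∖ {0}`: a polynomial `a_d t^d + ⋯ + a_0` with `a_d ≠ 0` is sent
to `(v a_d, d)`. -/
def extend (v : LatticeValuation k F n) (P : F[X]) : (Fin n → ℤ) × ℤ :=
  (v.toFun P.leadingCoeff, (P.natDegree : ℤ))

theorem extend_mul (v : LatticeValuation k F n) {P Q : F[X]} (hP : P ≠ 0) (hQ : Q ≠ 0) :
    v.extend (P * Q) = v.extend P + v.extend Q := by
  ext1
  · simp only [extend, leadingCoeff_mul, Prod.mk_add_mk]
    exact v.map_mul _ _ (leadingCoeff_ne_zero.mpr hP) (leadingCoeff_ne_zero.mpr hQ)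
  · simp [extend, natDegree_mul hP hQ]

/-- The value semigroup `S(A) = v_t (A ∖ {0})`. -/
def valueSemigroup (v : LatticeValuation k F n) (A : Subalgebra k F[X]) :
    AddSubsemigroup ((Fin n → ℤ) × ℤ) where
  carrier := {x | ∃ P ∈ A, P ≠ 0 ∧ v.extend P = x}
  add_mem' := by
    rintro _ _ ⟨P, hPA, hP, rfl⟩ ⟨Q, hQA, hQ, rfl⟩
    exact ⟨P * Q, A.mul_mem hPA hQA, mul_ne_zero hP hQ, v.extend_mul hP hQ⟩

end LatticeValuation

/-! ### Graded subalgebras of `F[t]` -/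

section Algebras

variable {k F : Type*} [Field k] [Field F] [Algebra k F]

/-- The `i`-th homogeneous component: all elements `a t^i` of `A`. -/
def homogeneousComponent (A : Subalgebra k F[X]) (i : ℕ) : Submodule k F[X] :=
  Subalgebra.toSubmodule A ⊓ LinearMap.range ((monomial i : F →ₗ[F] F[X]).restrictScalars k)

/-- `A` is graded: it contains the homogeneous parts of its elements. -/
def IsGraded (A : Subalgebra k F[X]) : Prop :=
  ∀ P ∈ A, ∀ i : ℕ, monomial i (P.coeff i) ∈ A

/-- The algebra `A_L = ⨁ L^i t^i`, where `L^0 = k` and `L^i` is the span of all `i`-fold products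
of elements of `L`. -/
def algebraOf (L : Submodule k F) : Subalgebra k F[X] where
  carrier := {P | ∀ i : ℕ, P.coeff i ∈ L ^ i}
  add_mem' := by
    intro P Q hP hQ i
    rw [coeff_add]
    exact (L ^ i).add_mem (hP i) (hQ i)
  mul_mem' := by
    intro P Q hP hQ i
    rw [coeff_mul]
    refine Submodule.sum_mem _ fun x hx => ?_
    rw [← Finset.HasAntidiagonal.mem_antidiagonal.mp hx, pow_add]
    exact Submodule.mul_mem_mul (hP _) (hQ _)
  algebraMap_mem' := by
    intro c i
    rw [Polynomial.algebraMap_apply, coeff_C]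
    split_ifs with h
    · subst h
      rw [pow_zero]
      exact Submodule.algebraMap_mem c
    · exact (L ^ i).zero_mem

/-- `A` is a graded subalgebra that is a finitely generated module over `A_L`, for some non-zero
finite-dimensional subspace `L` of `F`. (As `1 ∈ A`, the equality below forces `A_L ⊆ A`.) -/
def IsIntegralType (A : Subalgebra k F[X]) : Prop :=
  IsGraded A ∧ ∃ L : Submodule k F, L ≠ ⊥ ∧ FiniteDimensional k L ∧
    ∃ s : Finset F[X], (Submodule.span (algebraOf L) (s : Set F[X]) : Set F[X]) = (A : Set F[X])

/-- `A` is a graded subalgebra contained in an algebra of integral type. -/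
def IsAlmostIntegralType (A : Subalgebra k F[X]) : Prop :=
  IsGraded A ∧ ∃ B : Subalgebra k F[X], IsIntegralType B ∧ A ≤ B

/-- The Hilbert function `H_A(i) = dim_k A_i`, with value `∞` for infinite-dimensional `A_i`. -/
def hilbertFunction (A : Subalgebra k F[X]) (i : ℕ) : ℕ∞ :=
  Cardinal.toENat (Module.rank k (homogeneousComponent A i))

end Algebras

/-! ### Semigroups of integral points in `ℝⁿ × ℝ` -/

section Semigroups

variable {n : ℕ}

/-- The inclusion `ℤⁿ × ℤ ⊆ ℝⁿ × ℝ`. -/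
def toReal (n : ℕ) : (Fin n → ℤ) × ℤ →+ (Fin n → ℝ) × ℝ where
  toFun x := (fun i => (x.1 i : ℝ), (x.2 : ℝ))
  map_zero' := by ext <;> simp
  map_add' := by intro x y; ext <;> simp

/-- `L(S)`, the real span of `S`. -/
def realSpan (S : AddSubsemigroup ((Fin n → ℤ) × ℤ)) : Submodule ℝ ((Fin n → ℝ) × ℝ) :=
  Submodule.span ℝ (toReal n '' S)

/-- `Con(S)`, the closure of the set of all linear combinations of elements of `S` with
non-negative coefficients. -/
def cone (S : AddSubsemigroup ((Fin n → ℤ) × ℤ)) : Set ((Fin n → ℝ) × ℝ) :=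
  closure (PointedCone.hull ℝ (toReal n '' S) : Set ((Fin n → ℝ) × ℝ))

/-- `G(S)`, the group generated by `S`. -/
def group (S : AddSubsemigroup ((Fin n → ℤ) × ℤ)) : AddSubgroup ((Fin n → ℤ) × ℤ) :=
  AddSubgroup.closure (S : Set ((Fin n → ℤ) × ℤ))

/-- `∂M(S)`, the boundary of the half-space `M(S) = {x ∈ L(S) | x_{n+1} ≥ 0}` of `L(S)`. -/
def boundary (S : AddSubsemigroup ((Fin n → ℤ) × ℤ)) : Submodule ℝ ((Fin n → ℝ) × ℝ) :=
  realSpan S ⊓ LinearMap.ker (LinearMap.snd ℝ (Fin n → ℝ) ℝ)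

/-- `S` lies in the half-space `x_{n+1} ≥ 0` but not in the hyperplane `x_{n+1} = 0`. -/
def IsNonneg (S : AddSubsemigroup ((Fin n → ℤ) × ℤ)) : Prop :=
  (∀ x ∈ S, 0 ≤ x.2) ∧ ∃ x ∈ S, x.2 ≠ 0

/-- `S` is non-negative, its cone is strictly convex (contains no non-zero linear subspace) and
meets `∂M(S)` only at the origin. -/
def IsStronglyNonneg (S : AddSubsemigroup ((Fin n → ℤ) × ℤ)) : Prop :=
  IsNonneg S ∧
  (∀ W : Submodule ℝ ((Fin n → ℝ) × ℝ), (W : Set ((Fin n → ℝ) × ℝ)) ⊆ cone S → W = ⊥) ∧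
  cone S ∩ (boundary S : Set ((Fin n → ℝ) × ℝ)) = {0}

/-- `m(S)`, the index in `ℤ` of the image of `G(S)` under the last coordinate. -/
def levelIndex (S : AddSubsemigroup ((Fin n → ℤ) × ℤ)) : ℕ :=
  ((group S).map (AddMonoidHom.snd (Fin n → ℤ) ℤ)).index

/-- `G_0(S)`, the elements of `G(S)` at level `0`. -/
def groupZero (S : AddSubsemigroup ((Fin n → ℤ) × ℤ)) : AddSubgroup ((Fin n → ℤ) × ℤ) :=
  group S ⊓ (AddMonoidHom.snd (Fin n → ℤ) ℤ).ker

/-- The lattice `∂M(S) ∩ (ℤⁿ × ℤ)`. -/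
def boundaryLattice (S : AddSubsemigroup ((Fin n → ℤ) × ℤ)) : AddSubgroup ((Fin n → ℤ) × ℤ) :=
  (boundary S).toAddSubgroup.comap (toReal n)

/-- `ind(S)`, the index of `G_0(S)` in `∂M(S) ∩ (ℤⁿ × ℤ)`. -/
def boundaryIndex (S : AddSubsemigroup ((Fin n → ℤ) × ℤ)) : ℕ :=
  (groupZero S).relIndex (boundaryLattice S)

/-- The Newton-Okounkov convex set `Δ(S)`: the section of `Con(S)` at the level `m(S)`. -/
def newtonOkounkov (S : AddSubsemigroup ((Fin n → ℤ) × ℤ)) : Set ((Fin n → ℝ) × ℝ) :=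
  cone S ∩ {x | x.2 = (levelIndex S : ℝ)}

/-- The dimension of a non-empty convex set, i.e. the dimension of its affine hull. -/
def convexDim (Δ : Set ((Fin n → ℝ) × ℝ)) : ℕ :=
  Module.finrank ℝ (vectorSpan ℝ Δ)

/-- The integral points of a linear subspace `W` of `ℝⁿ × ℝ`. -/
def integralPoints (W : Submodule ℝ ((Fin n → ℝ) × ℝ)) : Submodule ℤ W :=
  AddSubgroup.toIntSubmodule ((toReal n).range.comap W.subtype.toAddMonoidHom)

open Classical in
/-- The integral volume `Vol_q(Δ)` of a set `Δ` whose affine hull is a rational affine subspace of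
dimension `q`: translate `Δ` to the direction space `W` of its affine hull, and measure it there by
the Lebesgue measure for which the parallelepipeds spanned by `ℤ`-bases of the integral
points of `W` have measure `1`. -/
def integralVolume (Δ : Set ((Fin n → ℝ) × ℝ)) : ℝ :=
  if h : Δ.Nonempty then
    (Measure.addHaar : Measure (vectorSpan ℝ Δ)).real
        {w | (w : (Fin n → ℝ) × ℝ) + h.some ∈ Δ} /
      ZLattice.covolume (integralPoints (vectorSpan ℝ Δ)) Measure.addHaar
  else 0

end Semigroups

end NewtonOkounkov

end

noncomputable section

namespace NewtonOkounkov

/-! ### Dimensions of subspaces and numbers of values -/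

section Values

variable {k F Γ : Type*} [Field k] [AddCommGroup F] [Module k F]

/-! Leaves of dimension at most one make the dimension of a subspace with finitely many values equal
to the number of its values (`finrank_eq_ncard_valueSet`). So H_A(i) counts the points of S(A) at
level i, and the theorem becomes a statement about counting points of a semigroup in ℤⁿ × ℤ. Two
facts carry it.

The first is a linear bound: S(A) lies in a cone |x_c| ≤ R t. Finiteness of H_A, strong
non-negativity and compactness of Δ(A) follow from it. The degree i coefficients of an algebra of
integral type lie in M^(i+1) for one finite-dimensional M containing 1
(`IsIntegralType.exists_coeff_mem_pow`); by faithfulness M can be chosen to take the unit vectors as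
values. Comparison with polynomials in a transcendence basis gives dim M^i = O(i^n)
(`exists_finrank_pow_le`), so M^i has O(i^n) values. A value much longer than i, combined with a box
of sums of unit vectors, would produce more (`natAbs_apply_le_of_ncard_le`).

The second is that a semigroup asymptotically fills the lattice points of its cone. Fix g in G(S) at
level m and translate level m l by -l g. Then S becomes a semigroup T generating L × ℤ, where L is
G_0(S), a full lattice in W = ∂M(S), and Δ(S) becomes the closed convex hull of the slopes x / l of
T. A fixed translation moves all lattice points of a suitable finitely generated cone into T
(`exists_nsmul_add_mem_of_cone`), so T contains, at every large level j, all lattice points of jK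
for K compact in the interior of the hull. Squeezing between Δ and slightly shrunken copies gives
the limit vol(Δ) / covol(L) (`tendsto_card_level_div_pow`). Finally covol(L) is ind(S) times the
covolume of the integral points of W (`covolume_div_covolume_eq_relIndex`). -/

/-- The set of values of the non-zero elements of a subspace. -/
def valueSet (w : F → Γ) (V : Submodule k F) : Set Γ := w '' {f | f ∈ V ∧ f ≠ 0}

theorem exists_value_representatives (w : F → Γ) (V : Submodule k F) :
    ∃ r : valueSet w V → F, ∀ α, r α ∈ V ∧ r α ≠ 0 ∧ w (r α) = α := by
  choose r hr using fun α : valueSet w V => α.2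
  exact ⟨r, fun α => ⟨(hr α).1.1, (hr α).1.2, (hr α).2⟩⟩

variable [LinearOrder Γ] {w : F → Γ}

theorem sum_eq_zero_or_lt_value
    (hadd : ∀ f g : F, f ≠ 0 → g ≠ 0 → f + g ≠ 0 → min (w f) (w g) ≤ w (f + g))
    {ι : Type*} {γ : Γ} (f : ι → F) (s : Finset ι) (hs : ∀ i ∈ s, f i = 0 ∨ γ < w (f i)) :
    ∑ i ∈ s, f i = 0 ∨ γ < w (∑ i ∈ s, f i) := by
  classical
  induction s using Finset.induction_on with
  | empty => simp
  | insert a s ha ih =>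
    rw [Finset.sum_insert ha]
    have h1 := hs a (Finset.mem_insert_self a s)
    have h2 := ih fun i hi => hs i (Finset.mem_insert_of_mem hi)
    by_cases h10 : f a = 0
    · simpa [h10] using h2
    by_cases h20 : ∑ i ∈ s, f i = 0
    · simpa [h20] using h1
    by_cases h30 : f a + ∑ i ∈ s, f i = 0
    · exact Or.inl h30
    exact Or.inr ((lt_min (h1.resolve_left h10) (h2.resolve_left h20)).trans_le
      (hadd _ _ h10 h20 h30))

/-- In a relation, the term of least value cannot be cancelled: the remaining terms have strictly
larger values, and so does their sum. -/
theorem linearIndependent_of_injective_value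
    (hadd : ∀ f g : F, f ≠ 0 → g ≠ 0 → f + g ≠ 0 → min (w f) (w g) ≤ w (f + g))
    (hsmul : ∀ (c : k) (f : F), c ≠ 0 → f ≠ 0 → w (c • f) = w f)
    {ι : Type*} (f : ι → F) (hf : ∀ i, f i ≠ 0) (hinj : Function.Injective fun i => w (f i)) :
    LinearIndependent k f := by
  classical
  rw [linearIndependent_iff']
  intro s g hg
  by_contra! hne
  obtain ⟨i, his, hi⟩ := hne
  obtain ⟨j, hj, hmin⟩ := (s.filter fun i => g i ≠ 0).exists_min_image (fun i => w (f i))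
    ⟨i, by simp [his, hi]⟩
  rw [Finset.mem_filter] at hj
  have hsum := sum_eq_zero_or_lt_value hadd (γ := w (f j)) (fun i => g i • f i) (s.erase j) (by
    intro l hl
    by_cases hgl : g l = 0
    · simp [hgl]
    right
    rw [hsmul _ _ hgl (hf l)]
    refine lt_of_le_of_ne (hmin l (by simp [Finset.mem_of_mem_erase hl, hgl])) fun h => ?_
    exact Finset.ne_of_mem_erase hl (hinj h).symm)
  rw [← Finset.add_sum_erase s _ hj.1] at hg
  have heq : ∑ x ∈ s.erase j, g x • f x = (-1 : k) • g j • f j := by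
    rw [neg_one_smul]; exact (neg_eq_of_add_eq_zero_right hg).symm
  have hne : g j • f j ≠ 0 := smul_ne_zero hj.2 (hf j)
  rw [heq] at hsum
  rcases hsum with h | h
  · exact smul_ne_zero (by simp) hne h
  · rw [hsmul _ _ (by simp) hne, hsmul _ _ hj.2 (hf j)] at h
    exact lt_irrefl _ h

theorem finite_valueSet_and_ncard_le
    (hadd : ∀ f g : F, f ≠ 0 → g ≠ 0 → f + g ≠ 0 → min (w f) (w g) ≤ w (f + g))
    (hsmul : ∀ (c : k) (f : F), c ≠ 0 → f ≠ 0 → w (c • f) = w f)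
    (V : Submodule k F) [FiniteDimensional k V] :
    (valueSet w V).Finite ∧ (valueSet w V).ncard ≤ Module.finrank k V := by
  obtain ⟨r, hr⟩ := exists_value_representatives w V
  have hli : LinearIndependent k fun α => (⟨r α, (hr α).1⟩ : V) := by
    refine LinearIndependent.of_comp V.subtype ?_
    refine linearIndependent_of_injective_value hadd hsmul _ (fun α => (hr α).2.1) ?_
    intro α β h
    exact Subtype.ext (by simpa [(hr _).2.2] using h)
  have hfin : Finite (valueSet w V) := hli.finite
  refine ⟨hfin, ?_⟩
  have := Fintype.ofFinite (valueSet w V)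
  rw [Set.ncard_eq_toFinset_card', Set.toFinset_card]
  exact hli.fintype_card_le_finrank

/-- One representative per value gives a basis. Independence needs no leaf hypothesis; for spanning,
subtract from f a multiple of the representative with the same value. This raises the value, which
can happen only finitely often. -/
theorem finrank_eq_ncard_valueSet
    (hadd : ∀ f g : F, f ≠ 0 → g ≠ 0 → f + g ≠ 0 → min (w f) (w g) ≤ w (f + g))
    (hsmul : ∀ (c : k) (f : F), c ≠ 0 → f ≠ 0 → w (c • f) = w f)
    (hleaf : ∀ f g : F, f ≠ 0 → g ≠ 0 → w f = w g →
      ∃ c : k, f - c • g = 0 ∨ w f < w (f - c • g))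
    (V : Submodule k F) (hV : (valueSet w V).Finite) :
    FiniteDimensional k V ∧ Module.finrank k V = (valueSet w V).ncard := by
  obtain ⟨r, hr⟩ := exists_value_representatives w V
  have : Finite (valueSet w V) := hV
  have hspan : Submodule.span k (Set.range r) = V := by
    refine le_antisymm (Submodule.span_le.2 ?_) fun f hf => ?_
    · rintro _ ⟨α, rfl⟩
      exact (hr α).1
    -- Descent on the number of values above that of f.
    · induction hN : {β ∈ valueSet w V | w f < β}.ncard using Nat.strong_induction_on
        generalizing f with
      | _ N ih =>
        by_cases hf0 : f = 0
        · simp [hf0]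
        have hα : w f ∈ valueSet w V := ⟨f, ⟨hf, hf0⟩, rfl⟩
        obtain ⟨hgV, hg0, hgw⟩ := hr ⟨w f, hα⟩
        set g := r ⟨w f, hα⟩ with hg
        have hgs : g ∈ Submodule.span k (Set.range r) := Submodule.subset_span ⟨_, hg.symm⟩
        obtain ⟨c, hc⟩ := hleaf f g hf0 hg0 hgw.symm
        by_cases hz : f - c • g = 0
        · rw [sub_eq_zero.1 hz]
          exact Submodule.smul_mem _ _ hgs
        have hlt := hc.resolve_left hz
        have hmem : f - c • g ∈ V := V.sub_mem hf (V.smul_mem _ hgV)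
        have := ih _ (by
          rw [← hN]
          refine Set.ncard_lt_ncard ⟨fun β hβ => ⟨hβ.1, hlt.trans hβ.2⟩, fun h => ?_⟩
            (hV.subset fun β hβ => hβ.1)
          have := h (a := w (f - c • g)) ⟨⟨_, ⟨hmem, hz⟩, rfl⟩, hlt⟩
          exact lt_irrefl _ this.2) _ hmem rfl
        simpa using Submodule.add_mem _ this (Submodule.smul_mem _ c hgs)
  have hli : LinearIndependent k r :=
    linearIndependent_of_injective_value hadd hsmul _ (fun α => (hr α).2.1) (by
      intro α β h
      exact Subtype.ext (by simpa [(hr _).2.2] using h))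
  have := Fintype.ofFinite (valueSet w V)
  rw [← hspan]
  refine ⟨FiniteDimensional.span_of_finite k (Set.finite_range r), ?_⟩
  rw [finrank_span_eq_card hli, hspan, Set.ncard_eq_toFinset_card', Set.toFinset_card]

end Values

/-! ### Specialization to lattice valuations -/

namespace LatticeValuation

variable {k F : Type*} [Field k] [Field F] [Algebra k F] {n : ℕ} (v : LatticeValuation k F n)

/-- The values taken on the non-zero elements of a subspace. -/
def values (V : Submodule k F) : Set (Fin n → ℤ) := v.toFun '' {f | f ∈ V ∧ f ≠ 0}

/-- The order is passed explicitly: `Fin n → ℤ` already carries the pointwise order as an instance,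
which is not `v.ord`. -/
theorem finite_values_and_ncard_le (V : Submodule k F) [FiniteDimensional k V] :
    (v.values V).Finite ∧ (v.values V).ncard ≤ Module.finrank k V :=
  @finite_valueSet_and_ncard_le k F _ _ _ _ v.ord v.toFun v.map_add v.map_smul V _

/-- The classes of f and g lie on one line of the leaf, and that of g is non-zero, so a scalar
multiple of g cancels the leading part of f. -/
theorem HasOneDimLeaves.exists_smul_sub {v : LatticeValuation k F n} (hv : v.HasOneDimLeaves)
    (f g : F) (hg : g ≠ 0) (hfg : v.toFun f = v.toFun g) :
    ∃ c : k, f - c • g = 0 ∨ v.ord.lt (v.toFun f) (v.toFun (f - c • g)) := by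
  obtain ⟨e, he⟩ := rank_le_one_iff.1 (hv (v.toFun f))
  have hmem : ∀ h : F, v.toFun h = v.toFun f → h ∈ v.subspaceGE (v.toFun f) :=
    fun h hh => Or.inr (by rw [hh]; exact v.ord.le_refl _)
  set q := ((v.subspaceGT (v.toFun f)).submoduleOf (v.subspaceGE (v.toFun f))).mkQ
  obtain ⟨a, ha⟩ := he (q ⟨f, hmem f rfl⟩)
  obtain ⟨b, hb⟩ := he (q ⟨g, hmem g hfg.symm⟩)
  have hb0 : b ≠ 0 := by
    rintro rfl
    rw [zero_smul] at hb
    have := (Submodule.Quotient.mk_eq_zero _).1 hb.symm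
    rcases this with h | h
    · exact hg h
    · change v.ord.lt (v.toFun f) (v.toFun g) at h
      rw [hfg] at h
      exact @lt_irrefl _ v.ord.toPreorder _ h
  refine ⟨a / b, ?_⟩
  have hq : q (⟨f, hmem f rfl⟩ - (a / b) • ⟨g, hmem g hfg.symm⟩) = 0 := by
    rw [map_sub, LinearMap.map_smul, ← ha, ← hb, smul_smul, div_mul_cancel₀ _ hb0, sub_self]
  exact (Submodule.Quotient.mk_eq_zero _).1 hq

theorem HasOneDimLeaves.finrank_eq_ncard {v : LatticeValuation k F n} (hv : v.HasOneDimLeaves)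
    (V : Submodule k F) (hV : (v.values V).Finite) :
    FiniteDimensional k V ∧ Module.finrank k V = (v.values V).ncard :=
  @finrank_eq_ncard_valueSet k F _ _ _ _ v.ord v.toFun v.map_add v.map_smul
    (fun f g _ hg h => hv.exists_smul_sub f g hg h) V hV

end LatticeValuation

/-! ### Growth of powers of a finite-dimensional subspace -/

section Growth

variable {k F : Type*} [Field k] [Field F] [Algebra k F]

/-- The elements of `F` that are polynomials in `x` of degree at most `N` in each variable. -/
def boundedPolys (k : Type*) {F : Type*} [Field k] [Field F] [Algebra k F] {n : ℕ}
    (x : Fin n → F) (N : ℕ) : Submodule k F :=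
  (MvPolynomial.restrictDegree (Fin n) k N).map (MvPolynomial.aeval x).toLinearMap

instance {n : ℕ} (x : Fin n → F) (N : ℕ) : FiniteDimensional k (boundedPolys k x N) :=
  inferInstanceAs (Module.Finite k (Submodule.map _ _))

theorem finrank_boundedPolys_le {n : ℕ} (x : Fin n → F) (N : ℕ) :
    Module.finrank k (boundedPolys k x N) ≤ (N + 1) ^ n := by
  refine (Submodule.finrank_map_le _ _).trans ?_
  have b := MvPolynomial.basisRestrictSupport k {m : Fin n →₀ ℕ | ∀ i, m i ≤ N}
  rw [MvPolynomial.restrictDegree, Module.finrank_eq_nat_card_basis b]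
  have hinj : Function.Injective fun (m : {m : Fin n →₀ ℕ | ∀ i, m i ≤ N}) (i : Fin n) =>
      (⟨(m : Fin n →₀ ℕ) i, Nat.lt_succ_of_le (m.2 i)⟩ : Fin (N + 1)) := by
    intro m m' h
    refine Subtype.ext (Finsupp.ext fun i => ?_)
    simpa using congrFun h i
  simpa using Nat.card_le_card_of_injective _ hinj

theorem boundedPolys_mono {n : ℕ} (x : Fin n → F) : Monotone (boundedPolys k x) := by
  intro N N' h
  refine Submodule.map_mono fun p hp => ?_
  rw [MvPolynomial.mem_restrictDegree] at hp ⊢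
  exact fun s hs i => (hp s hs i).trans h

theorem boundedPolys_mul_le {n : ℕ} (x : Fin n → F) (N N' : ℕ) :
    boundedPolys k x N * boundedPolys k x N' ≤ boundedPolys k x (N + N') := by
  classical
  rw [Submodule.mul_le]
  rintro _ ⟨p, hp, rfl⟩ _ ⟨q, hq, rfl⟩
  refine ⟨p * q, ?_, by simp⟩
  rw [SetLike.mem_coe, MvPolynomial.mem_restrictDegree] at hp hq ⊢
  intro s hs i
  obtain ⟨a, ha, b, hb, rfl⟩ := Finset.mem_add.1 (MvPolynomial.support_mul p q hs)
  exact add_le_add (hp a ha i) (hq b hb i)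

theorem one_mem_boundedPolys {n : ℕ} (x : Fin n → F) (N : ℕ) : (1 : F) ∈ boundedPolys k x N := by
  refine ⟨1, ?_, by simp⟩
  rw [SetLike.mem_coe, MvPolynomial.mem_restrictDegree]
  intro s hs i
  rw [← MvPolynomial.C_1, MvPolynomial.C_apply] at hs
  have := MvPolynomial.support_monomial_subset hs
  simp_all

theorem boundedPolys_pow_le {n : ℕ} (x : Fin n → F) (N i : ℕ) :
    boundedPolys k x N ^ i ≤ boundedPolys k x (i * N) := by
  induction i with
  | zero => simpa [Submodule.one_le] using one_mem_boundedPolys x 0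
  | succ i ih =>
    rw [pow_succ, add_one_mul]
    exact (mul_le_mul_left ih _).trans (boundedPolys_mul_le x _ _)

theorem exists_mem_boundedPolys {n : ℕ} (x : Fin n → F) {r : F}
    (hr : r ∈ Algebra.adjoin k (Set.range x)) : ∃ N, r ∈ boundedPolys k x N := by
  rw [Algebra.adjoin_range_eq_range_aeval] at hr
  obtain ⟨p, rfl⟩ := hr
  refine ⟨p.totalDegree, p, ?_, rfl⟩
  exact MvPolynomial.restrictTotalDegree_le_restrictDegree _ _ _
    ((MvPolynomial.mem_restrictTotalDegree _ _ _).2 le_rfl)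

theorem finrank_mul_le (V W : Submodule k F) [FiniteDimensional k V] [FiniteDimensional k W] :
    Module.finrank k ↥(V * W) ≤ Module.finrank k V * Module.finrank k W := by
  rw [← Submodule.mulMap_range, ← Module.finrank_tensorProduct (R := k)]
  exact LinearMap.finrank_range_le _

instance finiteDimensional_pow (V : Submodule k F) [FiniteDimensional k V] (i : ℕ) :
    FiniteDimensional k ↥(V ^ i) :=
  Module.Finite.iff_fg.2 (Submodule.FG.pow (Module.Finite.iff_fg.1 inferInstance) i)

theorem exists_mem_boundedPolys_mul {n : ℕ} (x : Fin n → F) (w : Set F) {y : F}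
    (hy : y ∈ Submodule.span (Algebra.adjoin k (Set.range x)) w) :
    ∃ N, y ∈ boundedPolys k x N * Submodule.span k w := by
  induction hy using Submodule.span_induction with
  | mem y hy =>
    refine ⟨0, ?_⟩
    simpa using Submodule.mul_mem_mul (one_mem_boundedPolys (k := k) x 0)
      (Submodule.subset_span (R := k) hy)
  | zero => exact ⟨0, Submodule.zero_mem _⟩
  | add y z _ _ hy hz =>
    obtain ⟨N, hN⟩ := hy
    obtain ⟨N', hN'⟩ := hz
    exact ⟨max N N', Submodule.add_mem _
      (mul_le_mul_left (boundedPolys_mono x (le_max_left _ _)) _ hN)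
      (mul_le_mul_left (boundedPolys_mono x (le_max_right _ _)) _ hN')⟩
  | smul a y _ hy =>
    obtain ⟨N, hN⟩ := hy
    obtain ⟨N', hN'⟩ := exists_mem_boundedPolys x a.2
    refine ⟨N' + N, mul_le_mul_left (boundedPolys_mul_le x N' N) _ ?_⟩
    rw [mul_assoc]
    exact Submodule.mul_mem_mul hN' hN

theorem exists_forall_le_boundedPolys_mul {n : ℕ} (x : Fin n → F) (w : Set F)
    (V : Submodule k F) [FiniteDimensional k V]
    (hV : ∀ y ∈ V, y ∈ Submodule.span (Algebra.adjoin k (Set.range x)) w) :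
    ∃ N, V ≤ boundedPolys k x N * Submodule.span k w := by
  obtain ⟨s, hs⟩ := Module.Finite.iff_fg.1 (inferInstance : Module.Finite k V)
  choose! N hN using fun y (hy : y ∈ (s : Set F)) => exists_mem_boundedPolys_mul x w
    (hV y (hs ▸ Submodule.subset_span hy))
  refine ⟨s.sup N, ?_⟩
  rw [← hs, Submodule.span_le]
  exact fun y hy => mul_le_mul_left (boundedPolys_mono x (Finset.le_sup hy)) _ (hN y hy)

/-- Up to a common denominator, M lies in a finite module over the polynomial ring in a
transcendence basis. Multiplying by a fixed space of module elements then raises polynomial degrees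
by a bounded amount D, so M^i costs degree iD in n variables. -/
theorem exists_finrank_pow_le {n : ℕ} (hn : Algebra.trdeg k F = (n : Cardinal))
    (M : Submodule k F) [FiniteDimensional k M] :
    ∃ C : ℕ, ∀ i, 0 < i → Module.finrank k ↥(M ^ i) ≤ C * i ^ n := by
  classical
  obtain ⟨ι, x₀, hx₀⟩ := exists_isTranscendenceBasis' k F
  have hcard : Cardinal.mk ι = n := by rw [hx₀.cardinalMk_eq_trdeg, hn]
  have : Finite ι := Cardinal.lt_aleph0_iff_finite.1 (hcard ▸ Cardinal.natCast_lt_aleph0)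
  have e : ι ≃ Fin n := Finite.equivFinOfCardEq (by simp [Nat.card, hcard])
  set x : Fin n → F := x₀ ∘ e.symm
  have hx : IsTranscendenceBasis k x := hx₀.comp_equiv e.symm
  set R := Algebra.adjoin k (Set.range x)
  have := hx.isAlgebraic
  obtain ⟨s, hs⟩ := Module.Finite.iff_fg.1 (inferInstance : Module.Finite k M)
  -- A common denominator a makes the generators of M integral over R, so that R[g] is a finite
  -- R-module.
  obtain ⟨a, ha0, ha⟩ : ∃ a : R, a ≠ 0 ∧ ∀ f ∈ s, IsIntegral R (a • f) :=
    Algebra.IsAlgebraic.exists_integral_multiples R s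
  set g : Set F := (fun f => (a : F) * f) '' s
  obtain ⟨w₀, hw₀⟩ : (Subalgebra.toSubmodule (Algebra.adjoin R g)).FG :=
    fg_adjoin_of_finite (s.finite_toSet.image _) (by
      rintro _ ⟨f, hf, rfl⟩
      exact ha f hf)
  -- Having 1 among the module generators gives G^i ≤ G^i W below.
  set w : Finset F := insert 1 w₀
  have hw : Submodule.span R (w : Set F) = Subalgebra.toSubmodule (Algebra.adjoin R g) := by
    rw [Finset.coe_insert, Submodule.span_insert, hw₀, sup_eq_right, Submodule.span_le]
    simp [one_mem]
  set W := Submodule.span k (w : Set F)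
  set G := Submodule.span k g
  have : FiniteDimensional k W := FiniteDimensional.span_of_finite k w.finite_toSet
  have : FiniteDimensional k G := FiniteDimensional.span_of_finite k (s.finite_toSet.image _)
  have hle : ∀ (t : Set F), t ⊆ Algebra.adjoin R g → ∀ y ∈ Submodule.span k t,
      y ∈ Algebra.adjoin R g := by
    intro t ht y hy
    exact (Submodule.span_le (p := (Subalgebra.toSubmodule
      (Algebra.adjoin R g)).restrictScalars k)).2 ht hy
  have : FiniteDimensional k ↥(G * W) := Module.Finite.iff_fg.2
    ((Module.Finite.iff_fg.1 inferInstance).mul (Module.Finite.iff_fg.1 inferInstance))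
  obtain ⟨D, hD⟩ := exists_forall_le_boundedPolys_mul x (w : Set F) (G * W) (by
    intro y hy
    change y ∈ Submodule.span R (w : Set F)
    rw [hw, Subalgebra.mem_toSubmodule]
    refine Submodule.mul_induction_on hy (fun p hp q hq => mul_mem ?_ ?_) fun _ _ => add_mem
    · exact hle g Algebra.subset_adjoin p hp
    · refine hle w (fun z hz => ?_) q hq
      have : z ∈ Submodule.span R (w : Set F) := Submodule.subset_span hz
      rwa [hw] at this)
  have hpow : ∀ i, G ^ i * W ≤ boundedPolys k x (i * D) * W := by
    intro i
    refine le_trans ?_ (mul_le_mul_left (boundedPolys_pow_le x D i) _)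
    induction i with
    | zero => simp
    | succ i ih =>
      rw [pow_succ, pow_succ, mul_assoc, mul_assoc]
      calc G ^ i * (G * W) ≤ G ^ i * (boundedPolys k x D * W) := mul_le_mul_right hD _
        _ = boundedPolys k x D * (G ^ i * W) := by ring
        _ ≤ boundedPolys k x D * (boundedPolys k x D ^ i * W) := mul_le_mul_right ih _
        _ = _ := by ring
  have h1W : 1 ≤ W := Submodule.one_le.2 (Submodule.subset_span (by simp [w]))
  have haF : (a : F) ≠ 0 := by simpa using ha0
  have hM : M ≤ Submodule.span k {(a : F)⁻¹} * G := by
    rw [← hs, Submodule.span_le]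
    intro f hf
    have := Submodule.mul_mem_mul (Submodule.mem_span_singleton_self (R := k) (a : F)⁻¹)
      (Submodule.subset_span (R := k) (Set.mem_image_of_mem (fun f => (a : F) * f) hf))
    simpa [haF] using this
  refine ⟨(D + 1) ^ n * Module.finrank k W, fun i hi => ?_⟩
  have hMi : M ^ i ≤ Submodule.span k {(a : F)⁻¹ ^ i} * (boundedPolys k x (i * D) * W) := by
    calc M ^ i ≤ (Submodule.span k {(a : F)⁻¹} * G) ^ i := pow_le_pow_left' hM i
      _ = Submodule.span k {(a : F)⁻¹ ^ i} * (G ^ i * 1) := by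
        rw [mul_pow, Submodule.span_pow, Set.singleton_pow, mul_one]
      _ ≤ Submodule.span k {(a : F)⁻¹ ^ i} * (G ^ i * W) :=
        mul_le_mul_right (mul_le_mul_right h1W _) _
      _ ≤ _ := mul_le_mul_right (hpow i) _
  have hfg : FiniteDimensional k ↥(boundedPolys k x (i * D) * W) := Module.Finite.iff_fg.2
    ((Module.Finite.iff_fg.1 inferInstance).mul (Module.Finite.iff_fg.1 inferInstance))
  have hfg' : FiniteDimensional k ↥(Submodule.span k {(a : F)⁻¹ ^ i} *
      (boundedPolys k x (i * D) * W)) := Module.Finite.iff_fg.2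
    ((Module.Finite.iff_fg.1 inferInstance).mul (Module.Finite.iff_fg.1 inferInstance))
  calc Module.finrank k ↥(M ^ i)
      ≤ Module.finrank k ↥(Submodule.span k {(a : F)⁻¹ ^ i} *
        (boundedPolys k x (i * D) * W)) := Submodule.finrank_mono hMi
    _ ≤ 1 * ((i * D + 1) ^ n * Module.finrank k W) := by
      refine (finrank_mul_le _ _).trans (Nat.mul_le_mul ?_ ?_)
      · exact (finrank_span_le_card _).trans (by simp)
      · exact (finrank_mul_le _ _).trans
          (Nat.mul_le_mul_right _ (finrank_boundedPolys_le x _))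
    _ ≤ ((D + 1) * i) ^ n * Module.finrank k W := by
      rw [one_mul]
      refine Nat.mul_le_mul_right _ (Nat.pow_le_pow_left ?_ n)
      nlinarith
    _ = _ := by rw [mul_pow]; ring

end Growth

/-! ### Linear bounds for graded families of lattice points -/

section LinearBound

variable {n : ℕ} {T : ℕ → Set (Fin n → ℤ)}

theorem natCast_mem_of_single_mem (hzero : ∀ i, 0 ∈ T i)
    (hadd : ∀ i j, ∀ x ∈ T i, ∀ y ∈ T j, x + y ∈ T (i + j))
    (hsingle : ∀ c, Pi.single c 1 ∈ T 1) (y : Fin n → ℕ) :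
    (fun d => (y d : ℤ)) ∈ T (∑ d, y d) := by
  have hmul : ∀ c (a : ℕ), a • (Pi.single c 1 : Fin n → ℤ) ∈ T a := by
    intro c a
    induction a with
    | zero => simpa using hzero 0
    | succ a ih => rw [succ_nsmul]; exact hadd _ _ _ ih _ (hsingle c)
  have hsum : ∀ s : Finset (Fin n),
      ∑ d ∈ s, y d • (Pi.single d 1 : Fin n → ℤ) ∈ T (∑ d ∈ s, y d) := by
    intro s
    induction s using Finset.induction_on with
    | empty => simpa using hzero 0
    | insert a s ha ih =>
      rw [Finset.sum_insert ha, Finset.sum_insert ha]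
      exact hadd _ _ _ (hmul _ _) _ ih
  convert! hsum Finset.univ using 1
  ext d
  simp [Finset.sum_apply, Pi.single_apply]

/-- Let h = |x_c|. The translates by a x, 0 ≤ a ≤ h, of a box of side h in direction c are disjoint,
since they advance by h in that direction. With the other sides equal to N = i(h+1), all these
points lie in T((n+1)N). Comparing h(h+1)N^(n-1) with C((n+1)N)^n gives h ≤ C(n+1)^n i. -/
theorem natAbs_apply_le_of_ncard_le (hzero : ∀ i, 0 ∈ T i)
    (hadd : ∀ i j, ∀ x ∈ T i, ∀ y ∈ T j, x + y ∈ T (i + j))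
    (hsingle : ∀ c, Pi.single c 1 ∈ T 1) {C : ℕ}
    (hcard : ∀ i, 0 < i → (T i).Finite ∧ (T i).ncard ≤ C * i ^ n)
    {i : ℕ} (hi : 0 < i) {x : Fin n → ℤ} (hx : x ∈ T i) (c : Fin n) :
    (x c).natAbs ≤ C * (n + 1) ^ n * i := by
  have hmono : ∀ a b, a ≤ b → T a ⊆ T b := by
    intro a b hab y hy
    have := hadd a (b - a) y hy 0 (hzero _)
    rwa [add_zero, Nat.add_sub_cancel' hab] at this
  have hmul : ∀ a : ℕ, a • x ∈ T (a * i) := by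
    intro a
    induction a with
    | zero => simpa using hzero 0
    | succ a ih => rw [succ_nsmul, add_one_mul]; exact hadd _ _ _ ih _ hx
  obtain ⟨h, hh⟩ : ∃ h, h = (x c).natAbs := ⟨_, rfl⟩
  rw [← hh]
  rcases Nat.eq_zero_or_pos h with h0 | hpos
  · simp [h0]
  obtain ⟨L, hL⟩ : ∃ L, L = h + 1 := ⟨_, rfl⟩
  -- This N makes a x, for a < L, cost at most N levels, no more than each side of the box.
  obtain ⟨N, hN⟩ : ∃ N, N = i * L := ⟨_, rfl⟩
  have hNpos : 0 < N := by rw [hN]; exact Nat.mul_pos hi (by omega)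
  have hhN : h ≤ N := by rw [hN, hL]; nlinarith
  set b : Fin n → ℕ := Function.update (fun _ => N) c h with hb
  have hbN : ∀ d, b d ≤ N := by
    intro d
    by_cases hd : d = c
    · subst hd; simpa [hb] using hhN
    · simp [hb, hd]
  let φ : Fin L × ((d : Fin n) → Fin (b d)) → (Fin n → ℤ) :=
    fun p => (p.1 : ℕ) • x + fun d => ((p.2 d : ℕ) : ℤ)
  have hφ : ∀ p, φ p ∈ T ((n + 1) * N) := by
    intro p
    have h1 := hmul p.1
    have h2 := natCast_mem_of_single_mem hzero hadd hsingle fun d => (p.2 d : ℕ)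
    refine hmono _ _ ?_ (hadd _ _ _ h1 _ h2)
    have h3 : ∑ d, (p.2 d : ℕ) ≤ ∑ _d : Fin n, N :=
      Finset.sum_le_sum fun d _ => (p.2 d).2.le.trans (hbN d)
    have h4 : (p.1 : ℕ) * i ≤ N := by
      rw [hN, mul_comm]; exact Nat.mul_le_mul_left _ p.1.2.le
    simp only [Finset.sum_const, Finset.card_univ, Fintype.card_fin, smul_eq_mul] at h3
    linarith
  have hinj : Function.Injective φ := by
    rintro ⟨a, y⟩ ⟨a', y'⟩ heq
    have hd : ∀ d, (a : ℤ) * x d + (y d : ℤ) = (a' : ℤ) * x d + (y' d : ℤ) := by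
      intro d
      simpa [φ] using congrFun heq d
    have hyb : ∀ z : (d : Fin n) → Fin (b d), (z c : ℤ) < |x c| := by
      intro z
      have := (z c).2
      have hbc : b c = h := by simp [hb]
      rw [Int.abs_eq_natAbs, ← hh]
      exact_mod_cast (hbc ▸ this : (z c : ℕ) < h)
    have hxc : x c ≠ 0 := by
      intro h0; rw [h0] at hh; simp at hh; omega
    have haa : (a : ℤ) = a' := by
      have h1 := hd c
      have h2 := hyb y
      have h3 := hyb y'
      have h4 : |((a : ℤ) - a') * x c| < |x c| := by
        have : ((a : ℤ) - a') * x c = (y' c : ℤ) - (y c : ℤ) := by linarith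
        rw [this, abs_lt]
        constructor <;> omega
      rw [abs_mul] at h4
      have h5 : |(a : ℤ) - a'| < 1 := by
        by_contra hcon
        push Not at hcon
        nlinarith [abs_nonneg (x c)]
      have := Int.abs_lt_one_iff.1 h5
      omega
    have hyy : y = y' := by
      funext d
      have := hd d
      rw [haa] at this
      exact Fin.ext (by exact_mod_cast add_left_cancel this)
    exact Prod.ext (Fin.ext (by exact_mod_cast haa)) hyy
  obtain ⟨hfin, hle⟩ := hcard ((n + 1) * N) (by positivity)
  have hcount : L * ∏ d, b d ≤ C * ((n + 1) * N) ^ n := by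
    refine le_trans ?_ hle
    have h1 : Nat.card (Fin L × ((d : Fin n) → Fin (b d))) = L * ∏ d, b d := by
      simp [Nat.card_eq_fintype_card, Fintype.card_pi]
    have : Finite (T ((n + 1) * N)) := hfin
    rw [← h1, ← Nat.card_coe_set_eq]
    exact Nat.card_le_card_of_injective (fun p => (⟨φ p, hφ p⟩ : T ((n + 1) * N)))
      fun p q hpq => hinj (congrArg Subtype.val hpq)
  -- The extra factor N avoids the exponent n - 1.
  have hprod : (∏ d, b d) * N = h * N ^ n := by
    rw [hb, Finset.prod_update_of_mem (Finset.mem_univ c), Finset.prod_const]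
    have : (Finset.univ \ {c}).card + 1 = n := by
      rw [Finset.card_sdiff_of_subset (Finset.subset_univ _)]
      simp
      have := c.pos
      omega
    rw [mul_assoc, ← pow_succ, this]
  have hfinal : h * (L * N ^ n) ≤ (C * (n + 1) ^ n * i) * (L * N ^ n) := by
    calc h * (L * N ^ n) = (L * ∏ d, b d) * N := by rw [mul_assoc, hprod]; ring
      _ ≤ (C * ((n + 1) * N) ^ n) * N := Nat.mul_le_mul_right _ hcount
      _ = (C * (n + 1) ^ n) * N ^ n * N := by rw [mul_pow]; ring
      _ = (C * (n + 1) ^ n) * N ^ n * (i * L) := by rw [← hN]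
      _ = _ := by ring
  exact Nat.le_of_mul_le_mul_right hfinal (Nat.mul_pos (by omega) (pow_pos hNpos n))

end LinearBound

/-! ### Values of powers of a subspace -/

namespace LatticeValuation

variable {k F : Type*} [Field k] [Field F] [Algebra k F] {n : ℕ} (v : LatticeValuation k F n)

theorem map_one : v.toFun 1 = 0 := by
  have := v.map_mul 1 1 one_ne_zero one_ne_zero
  rw [one_mul] at this
  simpa using this

theorem values_mono {V W : Submodule k F} (h : V ≤ W) : v.values V ⊆ v.values W :=
  Set.image_mono fun _ hf => ⟨h hf.1, hf.2⟩

theorem zero_mem_values {V : Submodule k F} (h : (1 : F) ∈ V) : 0 ∈ v.values V :=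
  ⟨1, ⟨h, one_ne_zero⟩, v.map_one⟩

theorem add_mem_values_mul {V W : Submodule k F} {x y : Fin n → ℤ} (hx : x ∈ v.values V)
    (hy : y ∈ v.values W) : x + y ∈ v.values (V * W) := by
  obtain ⟨f, ⟨hf, hf0⟩, rfl⟩ := hx
  obtain ⟨g, ⟨hg, hg0⟩, rfl⟩ := hy
  exact ⟨f * g, ⟨Submodule.mul_mem_mul hf hg, mul_ne_zero hf0 hg0⟩, v.map_mul f g hf0 hg0⟩

theorem exists_natAbs_values_pow_le (hn : Algebra.trdeg k F = (n : Cardinal))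
    (M : Submodule k F) [FiniteDimensional k M] (h1 : (1 : F) ∈ M)
    (hM : ∀ c, Pi.single c 1 ∈ v.values M) :
    ∃ R : ℕ, ∀ i, 0 < i → ∀ x ∈ v.values (M ^ i), ∀ c, (x c).natAbs ≤ R * i := by
  obtain ⟨C, hC⟩ := exists_finrank_pow_le hn M
  refine ⟨C * (n + 1) ^ n, fun i hi x hx c => ?_⟩
  refine natAbs_apply_le_of_ncard_le (T := fun i => v.values (M ^ i)) ?_ ?_ ?_ ?_ hi hx c
  · exact fun i => v.zero_mem_values (Submodule.one_le.1 (one_le_pow_of_one_le'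
      (Submodule.one_le.2 h1) i))
  · intro i j x hx y hy
    rw [pow_add]
    exact v.add_mem_values_mul hx hy
  · simpa using hM
  · intro i hi
    obtain ⟨h, h'⟩ := v.finite_values_and_ncard_le (M ^ i)
    exact ⟨h, h'.trans (hC i hi)⟩

end LatticeValuation

/-! ### The value semigroup of an algebra of almost integral type -/

section ValueSemigroup

variable {k F : Type*} [Field k] [Field F] [Algebra k F] {n : ℕ}

/-- The coefficients of the homogeneous elements of degree `i` of `A`. -/
def coefficientSpace (A : Subalgebra k F[X]) (i : ℕ) : Submodule k F :=
  (Subalgebra.toSubmodule A).comap ((monomial i : F →ₗ[F] F[X]).restrictScalars k)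

theorem homogeneousComponent_eq_map (A : Subalgebra k F[X]) (i : ℕ) :
    homogeneousComponent A i =
      (coefficientSpace A i).map ((monomial i : F →ₗ[F] F[X]).restrictScalars k) := by
  rw [homogeneousComponent, coefficientSpace, Submodule.map_comap_eq, inf_comm]

theorem rank_homogeneousComponent (A : Subalgebra k F[X]) (i : ℕ) :
    Module.rank k (homogeneousComponent A i) = Module.rank k (coefficientSpace A i) := by
  rw [homogeneousComponent_eq_map]
  refine (LinearEquiv.rank_eq (Submodule.equivMapOfInjective _ ?_ _)).symm
  exact monomial_injective i

/-- M is spanned by M₀, L, 1 and all coefficients of the module generators. In degree i the factor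
from A_L uses at most i elements of M and the generator one more, whence the exponent i + 1. The
freedom in M₀ serves to impose prescribed values on M. -/
theorem IsIntegralType.exists_coeff_mem_pow {B : Subalgebra k F[X]} (hB : IsIntegralType B)
    (M₀ : Submodule k F) [FiniteDimensional k M₀] :
    ∃ M : Submodule k F, FiniteDimensional k M ∧ M₀ ≤ M ∧ (1 : F) ∈ M ∧
      ∀ P ∈ B, ∀ i, P.coeff i ∈ M ^ (i + 1) := by
  classical
  obtain ⟨-, L, -, hL, s, hs⟩ := hB
  set c : Finset F := insert 1 (s.biUnion fun P => P.support.image P.coeff) with hc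
  set M := M₀ ⊔ L ⊔ Submodule.span k (c : Set F) with hM
  have : FiniteDimensional k (Submodule.span k (c : Set F)) :=
    FiniteDimensional.span_of_finite k c.finite_toSet
  have hcM : ∀ a ∈ c, a ∈ M := fun a ha =>
    (le_sup_right : _ ≤ M) (Submodule.subset_span (Finset.mem_coe.2 ha))
  have h1 : (1 : F) ∈ M := hcM 1 (Finset.mem_insert_self _ _)
  have hmono : ∀ a b, a ≤ b → M ^ a ≤ M ^ b := fun a b hab =>
    pow_le_pow_right' (Submodule.one_le.2 h1) hab
  have hLM : L ≤ M := le_sup_right.trans le_sup_left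
  refine ⟨M, inferInstance, le_sup_left.trans le_sup_left, h1, fun P hP => ?_⟩
  have hP' : P ∈ Submodule.span (algebraOf L) (s : Set F[X]) := by
    rw [← SetLike.mem_coe, hs]; exact hP
  induction hP' using Submodule.span_induction with
  | mem Q hQ =>
    intro i
    by_cases h0 : Q.coeff i = 0
    · rw [h0]; exact Submodule.zero_mem _
    refine hmono 1 (i + 1) (by omega) ?_
    rw [pow_one]
    refine hcM _ (Finset.mem_insert_of_mem (Finset.mem_biUnion.2 ⟨Q, hQ, ?_⟩))
    exact Finset.mem_image_of_mem _ (mem_support_iff.2 h0)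
  | zero => intro i; rw [coeff_zero]; exact Submodule.zero_mem _
  | add Q Q' hQ hQ' ih ih' =>
    intro i
    rw [coeff_add]
    refine Submodule.add_mem _ (ih ?_ i) (ih' ?_ i)
    · rw [← SetLike.mem_coe, ← hs]; exact hQ
    · rw [← SetLike.mem_coe, ← hs]; exact hQ'
  | smul a Q hQ ih =>
    intro i
    have ih := ih (by rw [← SetLike.mem_coe, ← hs]; exact hQ)
    change ((a : F[X]) * Q).coeff i ∈ _
    rw [coeff_mul]
    refine Submodule.sum_mem _ fun p hp => ?_
    rw [← Finset.HasAntidiagonal.mem_antidiagonal.1 hp, add_assoc, pow_add]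
    exact Submodule.mul_mem_mul (pow_le_pow_left' hLM _ (a.2 p.1)) (ih p.2)

theorem mem_valueSemigroup_iff (v : LatticeValuation k F n) {A : Subalgebra k F[X]}
    (hA : IsGraded A) {x : (Fin n → ℤ) × ℤ} :
    x ∈ v.valueSemigroup A ↔ ∃ i : ℕ, x.2 = i ∧ x.1 ∈ v.values (coefficientSpace A i) := by
  constructor
  · rintro ⟨P, hP, hP0, rfl⟩
    exact ⟨P.natDegree, rfl, P.leadingCoeff, ⟨hA P hP _, leadingCoeff_ne_zero.2 hP0⟩, rfl⟩
  · rintro ⟨i, hi, a, ⟨ha, ha0⟩, hv⟩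
    refine ⟨monomial i a, ha, by simpa using ha0, ?_⟩
    ext1
    · simpa [LatticeValuation.extend] using hv
    · simp [LatticeValuation.extend, natDegree_monomial_eq i ha0, hi]

theorem values_coefficientSpace_eq (v : LatticeValuation k F n) {A : Subalgebra k F[X]}
    (hA : IsGraded A) (i : ℕ) :
    v.values (coefficientSpace A i) = {y | (y, (i : ℤ)) ∈ v.valueSemigroup A} := by
  ext y
  rw [Set.mem_ofPred_eq, mem_valueSemigroup_iff v hA]
  constructor
  · exact fun h => ⟨i, rfl, h⟩
  · rintro ⟨j, hj, h⟩
    obtain rfl : i = j := Int.ofNat.inj hj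
    exact h

theorem nsmul_mem_addSubsemigroup {G : Type*} [AddMonoid G] (S : AddSubsemigroup G) {x : G}
    (hx : x ∈ S) (l : ℕ) : (l + 1) • x ∈ S := by
  induction l with
  | zero => simpa using hx
  | succ l ih => rw [succ_nsmul]; exact S.add_mem ih hx

/-- The estimate for powers of M gives R (t + 1) in place of R t; the extra constant is removed by
passing to a multiple of x. -/
theorem exists_abs_apply_le_of_mem_valueSemigroup (hn : Algebra.trdeg k F = (n : Cardinal))
    {v : LatticeValuation k F n} (hv : v.Faithful) {A : Subalgebra k F[X]}
    (hA : IsAlmostIntegralType A) :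
    ∃ R : ℕ, ∀ x ∈ v.valueSemigroup A, 0 ≤ x.2 ∧ ∀ c, |x.1 c| ≤ R * x.2 := by
  obtain ⟨hgr, B, hB, hAB⟩ := hA
  choose f hf0 hf using fun c : Fin n => hv (Pi.single c 1)
  have : FiniteDimensional k (Submodule.span k (Set.range f)) :=
    FiniteDimensional.span_of_finite k (Set.finite_range f)
  obtain ⟨M, hMfin, hM0, h1, hM⟩ := hB.exists_coeff_mem_pow (Submodule.span k (Set.range f))
  obtain ⟨R, hR⟩ := v.exists_natAbs_values_pow_le hn M h1 fun c =>
    ⟨f c, ⟨hM0 (Submodule.subset_span ⟨c, rfl⟩), hf0 c⟩, hf c⟩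
  have key : ∀ x ∈ v.valueSemigroup A, 0 ≤ x.2 ∧ ∀ c, |x.1 c| ≤ R * (x.2 + 1) := by
    intro x hx
    obtain ⟨i, hi, hxi⟩ := (mem_valueSemigroup_iff v hgr).1 hx
    have hle : coefficientSpace A i ≤ M ^ (i + 1) := fun a ha => by
      simpa using hM (monomial i a) (hAB ha) i
    refine ⟨by omega, fun c => ?_⟩
    have := hR (i + 1) (by omega) _ (v.values_mono hle hxi) c
    rw [Int.abs_eq_natAbs, hi]
    exact_mod_cast this
  refine ⟨R, fun x hx => ⟨(key x hx).1, fun c => ?_⟩⟩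
  -- For (R + 1) x the bound reads (R + 1)|x_c| ≤ R (R + 1) t + R, hence |x_c| < R t + 1, and both
  -- sides are integers.
  have h := (key _ (nsmul_mem_addSubsemigroup _ hx R)).2 c
  simp only [Prod.smul_fst, Prod.smul_snd, Pi.smul_apply] at h
  rw [nsmul_eq_mul, nsmul_eq_mul, abs_mul, Nat.abs_cast] at h
  push_cast at h
  by_contra hcon
  push Not at hcon
  nlinarith

theorem finite_setOf_abs_le (R : ℤ) : {y : Fin n → ℤ | ∀ c, |y c| ≤ R}.Finite := by
  refine (Set.Finite.pi' (t := fun _ : Fin n => Set.Icc (-R) R) fun _ =>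
    Set.finite_Icc _ _).subset fun y hy c => ?_
  exact abs_le.1 (hy c)

theorem hilbertFunction_eq_ncard {v : LatticeValuation k F n} (hv : v.HasOneDimLeaves)
    {A : Subalgebra k F[X]} (hA : IsGraded A) {R : ℕ}
    (hR : ∀ x ∈ v.valueSemigroup A, ∀ c, |x.1 c| ≤ R * x.2) (i : ℕ) :
    hilbertFunction A i = ({y | (y, (i : ℤ)) ∈ v.valueSemigroup A}.ncard : ℕ∞) := by
  have hfin : (v.values (coefficientSpace A i)).Finite := by
    rw [values_coefficientSpace_eq v hA]
    exact (finite_setOf_abs_le (R * i)).subset fun y hy c => hR _ hy c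
  obtain ⟨h1, h2⟩ := hv.finrank_eq_ncard _ hfin
  rw [← values_coefficientSpace_eq v hA, ← h2, hilbertFunction, rank_homogeneousComponent,
    ← Module.finrank_eq_rank, Cardinal.toENat_nat]

end ValueSemigroup

/-! ### Lattice points and volumes -/

section Covolume

open Module Submodule ZSpan

variable {E : Type*} [NormedAddCommGroup E] [NormedSpace ℝ E] [FiniteDimensional ℝ E]
  [MeasurableSpace E] [BorelSpace E] (μ : Measure E) [μ.IsAddHaarMeasure]

/-- Both sides are the absolute determinant of a ℤ-basis of L₁ written in a ℤ-basis of L₂. -/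
theorem covolume_div_covolume_eq_relIndex (L₁ L₂ : Submodule ℤ E)
    [DiscreteTopology L₁] [IsZLattice ℝ L₁] [DiscreteTopology L₂] [IsZLattice ℝ L₂] (h : L₁ ≤ L₂) :
    ZLattice.covolume L₁ μ / ZLattice.covolume L₂ μ =
      L₁.toAddSubgroup.relIndex L₂.toAddSubgroup := by
  classical
  let e : Free.ChooseBasisIndex ℤ L₂ ≃ Free.ChooseBasisIndex ℤ L₁ :=
    Fintype.equivOfCardEq (by
      rw [← finrank_eq_card_chooseBasisIndex, ← finrank_eq_card_chooseBasisIndex,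
        ZLattice.rank ℝ, ZLattice.rank ℝ])
  let b₁ := (Free.chooseBasis ℤ L₁).reindex e.symm
  let b₂ := Free.chooseBasis ℤ L₂
  let c : Free.ChooseBasisIndex ℤ L₂ → L₂ := fun i => ⟨b₁ i, h (coe_mem _)⟩
  have hidx : L₁.toAddSubgroup.relIndex L₂.toAddSubgroup = (b₂.toMatrix c).det.natAbs :=
    AddSubgroup.relIndex_eq_natAbs_det L₁.toAddSubgroup L₂.toAddSubgroup h b₁ b₂
  rw [hidx, Nat.cast_natAbs, Int.cast_abs, ZLattice.covolume_eq_det_mul_measureReal L₁ μ b₁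
      (b₂.ofZLatticeBasis ℝ), ← ZLattice.covolume_eq_measure_fundamentalDomain L₂ μ
      (ZLattice.isAddFundamentalDomain b₂ μ),
    mul_div_cancel_right₀ _ (ZLattice.covolume_ne_zero L₂ μ), Basis.det_apply, Int.cast_det]
  congr 2
  ext i j
  rw [Matrix.map_apply, Basis.toMatrix_apply, Basis.toMatrix_apply]
  exact b₂.ofZLatticeBasis_repr_apply ℝ L₂ (c j) i

/-- In coordinates of a ℤ-basis, μ becomes a multiple of Lebesgue measure; evaluation on the unit
cube identifies the factor as the covolume. -/
theorem volume_image_equivFun_eq_div_covolume (L : Submodule ℤ E)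
    [DiscreteTopology L] [IsZLattice ℝ L] {ι : Type*} [Fintype ι] (b : Basis ι ℤ L) (s : Set E) :
    volume.real ((b.ofZLatticeBasis ℝ).equivFun '' s) = μ.real s / ZLattice.covolume L μ := by
  set B := b.ofZLatticeBasis ℝ
  set e := B.equivFunL
  set ν := μ.map e
  have : ν.IsAddHaarMeasure := e.isAddHaarMeasure_map μ
  have hν : ∀ t : Set E, ν.real (B.equivFun '' t) = μ.real t := by
    intro t
    rw [measureReal_def, measureReal_def]
    congr 1
    have := e.toHomeomorph.toMeasurableEquiv.map_apply (μ := μ) (B.equivFun '' t)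
    refine this.trans ?_
    congr 1
    exact Set.preimage_image_eq t e.injective
  obtain ⟨c, hc⟩ : ∃ c : ℝ, ∀ t : Set (ι → ℝ), ν.real t = c * volume.real t := by
    refine ⟨(Measure.addHaarScalarFactor ν volume : NNReal), fun t => ?_⟩
    refine (congrArg (fun m : Measure (ι → ℝ) => m.real t)
      (Measure.isAddLeftInvariant_eq_smul ν volume)).trans ?_
    simp [measureReal_def]
  have hcov : ZLattice.covolume L μ = c := by
    classical
    have hB : B.map B.equivFun = Pi.basisFun ℝ ι := by
      refine Basis.eq_of_apply_eq fun i => ?_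
      ext l
      simp [Pi.single_apply, eq_comm]
    rw [ZLattice.covolume_eq_measure_fundamentalDomain L μ (ZLattice.isAddFundamentalDomain b μ),
      ← hν, hc, map_fundamentalDomain, hB, volume_real_fundamentalDomain, ← Pi.basisFun_det_apply,
      Basis.det_self, abs_one, mul_one]
  have hc0 : c ≠ 0 := hcov ▸ ZLattice.covolume_ne_zero L μ
  rw [← hν, hc, hcov, mul_div_cancel_left₀ _ hc0]

open Pointwise in
-- Lattice point counting applies because the frontier of a convex set is null.
theorem tendsto_card_inter_smul_lattice (L : Submodule ℤ E)
    [DiscreteTopology L] [IsZLattice ℝ L] {s : Set E} (hs : IsCompact s) (hconv : Convex ℝ s) :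
    Filter.Tendsto
      (fun j : ℕ => (Nat.card (s ∩ (j : ℝ)⁻¹ • L : Set E) : ℝ) / (j : ℝ) ^ finrank ℝ E)
      Filter.atTop (nhds (μ.real s / ZLattice.covolume L μ)) := by
  let b := Free.chooseBasis ℤ L
  have h := ZLattice.covolume.tendsto_card_div_pow'' b hs.isBounded hs.measurableSet
    ((hconv.linear_image (b.ofZLatticeBasis ℝ).equivFun.toLinearMap).addHaar_frontier _)
  rw [volume_image_equivFun_eq_div_covolume μ L b] at h
  rwa [← finrank_eq_card_chooseBasisIndex, ZLattice.rank ℝ L] at h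

end Covolume

/-! ### Semigroups of lattice points in a product with `ℤ` -/

section GradedLattice

open Submodule

variable {E : Type*} [NormedAddCommGroup E] [NormedSpace ℝ E]

/-- The point `x / l` attached to a pair `(x, l)`. -/
def slope (z : E × ℤ) : E := (z.2 : ℝ)⁻¹ • z.1

theorem sum_smul_mem_addSubsemigroup {G ι : Type*} [AddCommMonoid G] (T : AddSubsemigroup G)
    {s : Finset ι} (hs : s.Nonempty) (p : ι → G) (hp : ∀ i ∈ s, p i ∈ T) (c : ι → ℕ)
    (hc : ∀ i ∈ s, 0 < c i) : ∑ i ∈ s, c i • p i ∈ T := by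
  refine Finset.sum_induction_nonempty _ (· ∈ T) (fun _ _ => T.add_mem) hs fun i hi => ?_
  obtain ⟨l, hl⟩ := Nat.exists_eq_succ_of_ne_zero (hc i hi).ne'
  rw [hl]
  exact nsmul_mem_addSubsemigroup T (hp i hi) l

theorem sum_intCast_smul_mem_addSubsemigroup {G ι : Type*} [AddCommGroup G]
    (T : AddSubsemigroup G)
    {s : Finset ι} (hs : s.Nonempty) (p : ι → G) (hp : ∀ i ∈ s, p i ∈ T) (c : ι → ℤ)
    (hc : ∀ i ∈ s, 0 < c i) : ∑ i ∈ s, c i • p i ∈ T := by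
  have := sum_smul_mem_addSubsemigroup T hs p hp (fun i => (c i).toNat) (fun i hi => by
    have := hc i hi; omega)
  convert! this using 1
  refine Finset.sum_congr rfl fun i hi => ?_
  rw [← natCast_zsmul, Int.toNat_of_nonneg (hc i hi).le]

variable [FiniteDimensional ℝ E]

/-- A lattice point z = ∑ c_i p_i of the cone differs from ∑ ⌊c_i⌋ p_i by a lattice point of a
bounded region. There are finitely many such remainders, each an integral combination of the p_i; N
exceeds every negative coefficient that occurs, so adding N ∑ p_i makes all coefficients positive.
-/
theorem exists_nsmul_add_mem_of_cone (L : Submodule ℤ E) [DiscreteTopology L]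
    (T : AddSubsemigroup (E × ℤ)) {ι : Type*} [Fintype ι] [Nonempty ι] (p : ι → E × ℤ)
    (hp : ∀ i, p i ∈ T) (hpL : ∀ i, (p i).1 ∈ L)
    (hgen : ∀ z : E × ℤ, z.1 ∈ L → z ∈ span ℤ (Set.range p)) :
    ∃ N : ℕ, ∀ c : ι → ℝ, (∀ i, 0 ≤ c i) → ∀ z : E × ℤ, z.1 ∈ L →
      z.1 = ∑ i, c i • (p i).1 → (z.2 : ℝ) = ∑ i, c i * (p i).2 → z + N • ∑ i, p i ∈ T := by
  classical
  set Z : Set (E × ℤ) := {z | z.1 ∈ L ∧ ‖z.1‖ ≤ ∑ i, ‖(p i).1‖ ∧ |z.2| ≤ ∑ i, |(p i).2|} with hZ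
  have hZfin : Z.Finite := by
    have h1 : {x : E | x ∈ L ∧ ‖x‖ ≤ ∑ i, ‖(p i).1‖}.Finite := by
      have := Metric.finite_isBounded_inter_isClosed (s := (L : Set E))
        (K := Metric.closedBall 0 (∑ i, ‖(p i).1‖)) ⟨inferInstanceAs (DiscreteTopology L)⟩
        Metric.isBounded_closedBall
        (AddSubgroup.isClosed_of_discrete (H := L.toAddSubgroup))
      refine this.subset fun x hx => ⟨by simpa using hx.2, hx.1⟩
    refine (h1.prod (Set.finite_Icc (-∑ i, |(p i).2|) (∑ i, |(p i).2|))).subset fun z hz => ?_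
    exact ⟨⟨hz.1, hz.2.1⟩, abs_le.1 hz.2.2⟩
  choose! m hm using fun z (hz : z ∈ Z) => (mem_span_range_iff_exists_fun ℤ).1 (hgen z hz.1)
  -- The summand 1 makes the final coefficients strictly positive: T need not contain 0.
  set N : ℕ := ∑ z ∈ hZfin.toFinset, ∑ i, (m z i).natAbs + 1
  have hN : ∀ z ∈ Z, ∀ i, -(N : ℤ) < m z i := by
    intro z hz i
    have h1 : (m z i).natAbs ≤ ∑ i, (m z i).natAbs :=
      Finset.single_le_sum (f := fun i => (m z i).natAbs) (fun _ _ => Nat.zero_le _)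
        (Finset.mem_univ i)
    have h2 : ∑ i, (m z i).natAbs ≤ ∑ z ∈ hZfin.toFinset, ∑ i, (m z i).natAbs :=
      Finset.single_le_sum (f := fun z => ∑ i, (m z i).natAbs) (fun _ _ => Nat.zero_le _)
        (hZfin.mem_toFinset.2 hz)
    omega
  refine ⟨N, fun c hc z hzL hz1 hz2 => ?_⟩
  set r : E × ℤ := z - ∑ i, ⌊c i⌋ • p i with hr
  have hr1 : r.1 = ∑ i, Int.fract (c i) • (p i).1 := by
    simp only [hr, Prod.fst_sub, Prod.fst_sum, Prod.smul_fst, hz1, ← Finset.sum_sub_distrib]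
    refine Finset.sum_congr rfl fun i _ => ?_
    rw [← Int.self_sub_floor, sub_smul, Int.cast_smul_eq_zsmul]
  have hr2 : (r.2 : ℝ) = ∑ i, Int.fract (c i) * (p i).2 := by
    simp only [hr, Prod.snd_sub, Prod.snd_sum, Prod.smul_snd, Int.cast_sub, Int.cast_sum, hz2,
      ← Finset.sum_sub_distrib]
    refine Finset.sum_congr rfl fun i _ => ?_
    rw [← Int.self_sub_floor, sub_mul]
    simp
  have hrZ : r ∈ Z := by
    refine ⟨?_, ?_, ?_⟩
    · simp only [hr, Prod.fst_sub, Prod.fst_sum, Prod.smul_fst]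
      exact L.sub_mem hzL (L.sum_mem fun i _ => L.smul_mem _ (hpL i))
    · rw [hr1]
      refine (norm_sum_le _ _).trans (Finset.sum_le_sum fun i _ => ?_)
      rw [norm_smul, Real.norm_eq_abs, Int.abs_fract]
      exact mul_le_of_le_one_left (norm_nonneg _) (Int.fract_lt_one _).le
    · rw [← Int.cast_le (R := ℝ), Int.cast_abs, hr2, Int.cast_sum]
      refine (Finset.abs_sum_le_sum_abs _ _).trans (Finset.sum_le_sum fun i _ => ?_)
      rw [abs_mul, Int.abs_fract, Int.cast_abs]
      exact mul_le_of_le_one_left (abs_nonneg _) (Int.fract_lt_one _).le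
  have hz : z + N • ∑ i, p i = ∑ i, (⌊c i⌋ + m r i + N) • p i := by
    have h1 : z = r + ∑ i, ⌊c i⌋ • p i := by rw [hr, sub_add_cancel]
    simp only [add_smul, Finset.sum_add_distrib, Finset.smul_sum, natCast_zsmul, hm r hrZ]
    nth_rewrite 1 [h1]
    abel
  rw [hz]
  refine sum_intCast_smul_mem_addSubsemigroup T Finset.univ_nonempty p (fun i _ => hp i) _
    fun i _ => ?_
  have h1 := hN r hrZ i
  have h2 := Int.floor_nonneg.2 (hc i)
  omega

/-- Each point of K is interior to a simplex with vertices in the hull of P, and each vertex needs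
only finitely many points of P. The resulting open sets form a directed cover of K. -/
theorem exists_finset_subset_interior_convexHull {P K : Set E} (hK : IsCompact K)
    (hKP : K ⊆ interior (convexHull ℝ P)) :
    ∃ u : Finset E, (u : Set E) ⊆ P ∧ K ⊆ interior (convexHull ℝ (u : Set E)) := by
  classical
  have : Nonempty {u : Finset E // (u : Set E) ⊆ P} := ⟨⟨∅, by simp⟩⟩
  let U : {u : Finset E // (u : Set E) ⊆ P} → Set E :=
    fun u => interior (convexHull ℝ ((u : Finset E) : Set E))
  have hcover : K ⊆ ⋃ u, U u := by
    intro x hx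
    obtain ⟨b, hxb, hbP⟩ := exists_mem_interior_convexHull_affineBasis
      (mem_interior_iff_mem_nhds.1 (hKP hx))
    have hb : ∀ i, ∃ t : Finset E, (t : Set E) ⊆ P ∧ b i ∈ convexHull ℝ (t : Set E) := by
      intro i
      have := hbP (subset_convexHull ℝ _ ⟨i, rfl⟩)
      rw [convexHull_eq_union_convexHull_finite_subsets] at this
      simpa using this
    choose t htP hbt using hb
    rw [Set.mem_iUnion]
    refine ⟨⟨Finset.univ.biUnion t, by simpa using htP⟩, ?_⟩
    refine interior_mono (convexHull_min ?_ (convex_convexHull ℝ _)) hxb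
    rintro _ ⟨i, rfl⟩
    exact convexHull_mono (by
      simpa using Set.subset_iUnion (fun i => (t i : Set E)) i) (hbt i)
  have hdir : Directed (· ⊆ ·) U := fun u v =>
    ⟨⟨u ∪ v, by simpa using ⟨u.2, v.2⟩⟩,
      interior_mono (convexHull_mono (by simp)), interior_mono (convexHull_mono (by simp))⟩
  obtain ⟨u, hu⟩ := hK.elim_directed_cover U (fun u => isOpen_interior) hcover hdir
  exact ⟨u, u.2, hu⟩

/-- Choose finitely many elements of T that generate the group and whose slopes surround K.
Subtracting the fixed vector Nσ from (x, j) moves its slope by O(1/j), so for large j the difference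
is still in their cone, and adding Nσ back lands in T. -/
theorem eventually_mem_of_subset_interior (L : Submodule ℤ E) [DiscreteTopology L]
    [IsZLattice ℝ L] (T : AddSubsemigroup (E × ℤ)) (hpos : ∀ z ∈ T, 0 < z.2)
    (hTL : ∀ z ∈ T, z.1 ∈ L)
    (hgen : ∀ z : E × ℤ, z.1 ∈ L → z ∈ span ℤ (T : Set (E × ℤ)))
    {K : Set E} (hK : IsCompact K)
    (hKT : K ⊆ interior (convexHull ℝ (slope '' (T : Set (E × ℤ))))) :
    ∀ᶠ j : ℕ in Filter.atTop, ∀ x ∈ L, (j : ℝ)⁻¹ • x ∈ K → (x, (j : ℤ)) ∈ T := by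
  classical
  obtain ⟨u, huP, hKu⟩ := exists_finset_subset_interior_convexHull hK hKT
  obtain ⟨t₁, ht₁, rfl⟩ := Finset.subset_set_image_iff.1 huP
  have hspan : span ℤ (T : Set (E × ℤ)) = L.prod ⊤ :=
    le_antisymm (span_le.2 fun z hz => ⟨hTL z hz, trivial⟩) fun z hz => hgen z hz.1
  have hfg : (span ℤ (T : Set (E × ℤ))).FG := by
    rw [hspan]
    exact (ZLattice.FG ℝ L).prod Module.Finite.fg_top
  obtain ⟨t₂, ht₂, htspan⟩ := (fg_span_iff_fg_span_finset_subset _).1 hfg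
  set t := t₁ ∪ t₂ with ht
  have htT : ∀ z ∈ t, z ∈ T := by
    intro z hz
    rcases Finset.mem_union.1 hz with h | h
    · exact ht₁ h
    · exact ht₂ h
  have htgen : ∀ z : E × ℤ, z.1 ∈ L → z ∈ span ℤ (Set.range ((↑) : t → E × ℤ)) := by
    intro z hz
    have := hgen z hz
    rw [htspan] at this
    refine span_mono ?_ this
    rw [Subtype.range_coe_subtype]
    exact fun y hy => Finset.mem_union_right _ hy
  have htne : Nonempty t := by
    by_contra hcon
    rw [not_nonempty_iff] at hcon
    have := htgen (0, 1) L.zero_mem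
    rw [Set.range_eq_empty, span_empty, mem_bot] at this
    exact one_ne_zero (congrArg Prod.snd this)
  obtain ⟨N, hN⟩ := exists_nsmul_add_mem_of_cone L T ((↑) : t → E × ℤ) (fun i => htT _ i.2)
    (fun i => hTL _ (htT _ i.2)) htgen
  set U := interior (convexHull ℝ (slope '' (t : Set (E × ℤ))))
  have hKU : K ⊆ U := hKu.trans (interior_mono (convexHull_mono (by
    rw [Finset.coe_image]
    exact Set.image_mono (by simp [ht]))))
  obtain ⟨δ, hδ, hδU⟩ := hK.exists_thickening_subset_open isOpen_interior hKU
  obtain ⟨R, hR⟩ := hK.isBounded.exists_norm_le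
  set σ : E × ℤ := ∑ i : t, (i : E × ℤ) with hσ
  set b : ℝ := N * σ.2 with hb
  set a : E := (N : ℝ) • σ.1 with ha
  have hlim : Filter.Tendsto (fun j : ℕ => ((j : ℝ) - b)⁻¹ * (|b| * R + ‖a‖)) Filter.atTop
      (nhds 0) := by
    have : Filter.Tendsto (fun j : ℕ => ((j : ℝ) - b)) Filter.atTop Filter.atTop :=
      Filter.tendsto_atTop_add_const_right _ (-b) tendsto_natCast_atTop_atTop
    simpa using this.inv_tendsto_atTop.mul_const (|b| * R + ‖a‖)
  filter_upwards [hlim.eventually_lt_const hδ,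
    (tendsto_natCast_atTop_atTop (R := ℝ)).eventually_gt_atTop (max b 0)] with j hj hjb x hxL hx
  have hj0 : (j : ℝ) ≠ 0 := ((le_max_right _ _).trans_lt hjb).ne'
  have hjb' : 0 < (j : ℝ) - b := sub_pos.2 ((le_max_left _ _).trans_lt hjb)
  set κ := (j : ℝ)⁻¹ • x with hκ
  have hxκ : x = (j : ℝ) • κ := by rw [hκ, smul_inv_smul₀ hj0]
  set κ' := ((j : ℝ) - b)⁻¹ • (x - a) with hκ'
  have hdist : dist κ' κ < δ := by
    have : κ' - κ = ((j : ℝ) - b)⁻¹ • (b • κ - a) := by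
      rw [eq_inv_smul_iff₀ hjb'.ne', smul_sub, hκ', smul_inv_smul₀ hjb'.ne', sub_smul, ← hxκ]
      abel
    rw [dist_eq_norm, this, norm_smul, Real.norm_eq_abs, abs_of_pos (inv_pos.2 hjb')]
    refine lt_of_le_of_lt (mul_le_mul_of_nonneg_left ?_ (inv_pos.2 hjb').le) hj
    refine (norm_sub_le _ _).trans (add_le_add_left ?_ _)
    rw [norm_smul, Real.norm_eq_abs]
    exact mul_le_mul_of_nonneg_left (hR _ hx) (abs_nonneg _)
  have hmem : κ' ∈ convexHull ℝ (Set.range fun i : t => slope (i : E × ℤ)) := by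
    have := interior_subset (hδU (Metric.mem_thickening_iff.2 ⟨κ, hx, hdist⟩))
    convert! this using 2
    ext y
    simp
  rw [convexHull_range_eq_exists_affineCombination] at hmem
  obtain ⟨s, w, hw0, hw1, hw⟩ := hmem
  rw [s.affineCombination_eq_linear_combination _ _ hw1] at hw
  have hl : ∀ i : t, ((i : E × ℤ).2 : ℝ) ≠ 0 := fun i => by
    exact_mod_cast (hpos _ (htT _ i.2)).ne'
  -- A convex combination of slopes becomes a conic combination of the points themselves: divide
  -- each weight by its level and scale by the level j - b of the difference.
  set c : t → ℝ := fun i => if i ∈ s then ((j : ℝ) - b) * w i * ((i : E × ℤ).2 : ℝ)⁻¹ else 0 with hc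
  have hfin := hN c (fun i => ?_) ((x, (j : ℤ)) - N • σ) ?_ ?_ ?_
  · rwa [sub_add_cancel] at hfin
  · rw [hc]
    dsimp only
    split_ifs with h
    · refine mul_nonneg (mul_nonneg hjb'.le (hw0 i h)) (inv_nonneg.2 ?_)
      exact_mod_cast (hpos _ (htT _ i.2)).le
    · exact le_rfl
  · refine L.sub_mem hxL ?_
    rw [Prod.smul_fst, hσ, Prod.fst_sum]
    exact L.smul_of_tower_mem N (L.sum_mem fun i _ => hTL _ (htT _ i.2))
  · have h1 : x - a = ((j : ℝ) - b) • κ' := by rw [hκ', smul_inv_smul₀ hjb'.ne']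
    have h2 : ((x, (j : ℤ)) - N • σ).1 = x - a := by simp [ha, Nat.cast_smul_eq_nsmul]
    rw [h2, h1, ← hw, Finset.smul_sum]
    simp only [hc, ite_smul, zero_smul, Finset.sum_ite_mem, Finset.univ_inter]
    refine Finset.sum_congr rfl fun i _ => ?_
    rw [slope, smul_smul, smul_smul]
  · have h2 : ((((x, (j : ℤ)) - N • σ).2 : ℤ) : ℝ) = j - b := by simp [hb]
    rw [h2]
    simp only [hc, ite_mul, zero_mul, Finset.sum_ite_mem, Finset.univ_inter]
    calc (j : ℝ) - b = ((j : ℝ) - b) * ∑ i ∈ s, w i := by rw [hw1, mul_one]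
      _ = _ := by
        rw [Finset.mul_sum]
        refine Finset.sum_congr rfl fun i _ => ?_
        rw [inv_mul_cancel_right₀ (hl i)]

/-- The condition z.1 - z.2 · slope z₀ ∈ V is additive in z and holds on T, hence on the group T
generates. At level 0 it says L ⊆ V, and L spans E. -/
theorem interior_convexHull_slope_nonempty (L : Submodule ℤ E) [DiscreteTopology L]
    [IsZLattice ℝ L] (T : AddSubsemigroup (E × ℤ)) (hpos : ∀ z ∈ T, 0 < z.2)
    (hgen : ∀ z : E × ℤ, z.1 ∈ L → z ∈ span ℤ (T : Set (E × ℤ))) :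
    (interior (convexHull ℝ (slope '' (T : Set (E × ℤ))))).Nonempty := by
  have hne : (T : Set (E × ℤ)).Nonempty := by
    by_contra hcon
    rw [Set.not_nonempty_iff_eq_empty] at hcon
    have := hgen (0, 1) L.zero_mem
    rw [hcon] at this
    simp at this
  obtain ⟨z₀, hz₀⟩ := hne
  rw [interior_convexHull_nonempty_iff_affineSpan_eq_top,
    AffineSubspace.affineSpan_eq_top_iff_vectorSpan_eq_top_of_nonempty ℝ E E
      (Set.Nonempty.image slope ⟨z₀, hz₀⟩)]
  set V := vectorSpan ℝ (slope '' (T : Set (E × ℤ)))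
  have hsub : span ℤ (T : Set (E × ℤ)) ≤ (V.restrictScalars ℤ).comap
      (LinearMap.fst ℤ E ℤ - (LinearMap.toSpanSingleton ℤ E (slope z₀)).comp
        (LinearMap.snd ℤ E ℤ)) := by
    rw [span_le]
    intro z hz
    have h1 := vsub_mem_vectorSpan ℝ (Set.mem_image_of_mem slope (show z ∈ (T : Set _) from hz))
      (Set.mem_image_of_mem slope (show z₀ ∈ (T : Set _) from hz₀))
    have h2 := V.smul_mem (z.2 : ℝ) h1
    have hz2 : (z.2 : ℝ) ≠ 0 := by exact_mod_cast (hpos z hz).ne'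
    have h3 : (z.2 : ℝ) • slope z = z.1 := by rw [slope, smul_inv_smul₀ hz2]
    rw [vsub_eq_sub, smul_sub, h3, Int.cast_smul_eq_zsmul] at h2
    simpa using h2
  have key : ∀ z : E × ℤ, z.1 ∈ L → z.1 - z.2 • slope z₀ ∈ V := fun z hz => by
    simpa using hsub (hgen z hz)
  rw [eq_top_iff, ← IsZLattice.span_top (K := ℝ) (L := L), span_le]
  intro x hx
  simpa using key (x, 0) hx

end GradedLattice

/-! ### Asymptotic count of the points at level j -/

section GradedLatticeCount

open Submodule

variable {E : Type*} [NormedAddCommGroup E] [NormedSpace ℝ E]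

open Pointwise in
theorem card_inter_smul_lattice_le_card_level (L : Submodule ℤ E)
    (T : Set (E × ℤ)) {K : Set E} {j : ℕ} (hj : 0 < j)
    (hfin : Finite {x : E | (x, (j : ℤ)) ∈ T})
    (hKT : ∀ x ∈ L, (j : ℝ)⁻¹ • x ∈ K → (x, (j : ℤ)) ∈ T) :
    Nat.card (K ∩ (j : ℝ)⁻¹ • L : Set E) ≤ Nat.card {x : E | (x, (j : ℤ)) ∈ T} := by
  have hj0 : (j : ℝ) ≠ 0 := by exact_mod_cast hj.ne'
  refine Nat.card_le_card_of_injective (fun x => ⟨(j : ℝ) • (x : E), ?_⟩) fun x y hxy => ?_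
  · have hx := x.2.2
    rw [Set.mem_inv_smul_set_iff₀ hj0] at hx
    refine hKT _ hx ?_
    rw [inv_smul_smul₀ hj0]
    exact x.2.1
  · have := congrArg Subtype.val hxy
    exact Subtype.ext (smul_right_injective E hj0 this)

variable [FiniteDimensional ℝ E]

open Pointwise in
theorem card_level_le_card_inter_smul_lattice (L : Submodule ℤ E) [DiscreteTopology L]
    (T : Set (E × ℤ)) (hTL : ∀ z ∈ T, z.1 ∈ L) {K : Set E}
    (hK : IsCompact K) (hTK : ∀ z ∈ T, slope z ∈ K) {j : ℕ} (hj : 0 < j) :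
    Finite ↥(K ∩ (j : ℝ)⁻¹ • L : Set E) ∧
    Nat.card {x : E | (x, (j : ℤ)) ∈ T} ≤ Nat.card (K ∩ (j : ℝ)⁻¹ • L : Set E) := by
  have hj0 : (j : ℝ) ≠ 0 := by exact_mod_cast hj.ne'
  have hfin : ((fun x : E => (j : ℝ) • x) '' K ∩ (L : Set E)).Finite :=
    Metric.finite_isBounded_inter_isClosed ⟨inferInstanceAs (DiscreteTopology L)⟩
      (hK.image (continuous_const_smul _)).isBounded
      (AddSubgroup.isClosed_of_discrete (H := L.toAddSubgroup))
  have hfin' : Finite ↥(K ∩ (j : ℝ)⁻¹ • L : Set E) := by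
    refine (Set.Finite.preimage (f := fun x : E => (j : ℝ) • x)
      (smul_right_injective E hj0).injOn hfin).subset ?_
    rintro x ⟨hx, hxL⟩
    rw [Set.mem_inv_smul_set_iff₀ hj0] at hxL
    exact ⟨⟨x, hx, rfl⟩, hxL⟩
  refine ⟨hfin', Nat.card_le_card_of_injective
    (fun x => ⟨(j : ℝ)⁻¹ • (x : E), ?_, ?_⟩) fun x y hxy => ?_⟩
  · have := hTK _ x.2
    simpa [slope] using this
  · exact Set.smul_mem_smul_set (hTL _ x.2)
  · have := congrArg Subtype.val hxy
    exact Subtype.ext (smul_right_injective E (inv_ne_zero hj0) this)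

variable [MeasurableSpace E] [BorelSpace E] (μ : Measure E) [μ.IsAddHaarMeasure]

theorem tendsto_card_level_div_pow (L : Submodule ℤ E) [DiscreteTopology L]
    [IsZLattice ℝ L] (T : AddSubsemigroup (E × ℤ)) (hpos : ∀ z ∈ T, 0 < z.2)
    (hTL : ∀ z ∈ T, z.1 ∈ L)
    (hgen : ∀ z : E × ℤ, z.1 ∈ L → z ∈ span ℤ (T : Set (E × ℤ)))
    {K : Set E} (hK : IsCompact K)
    (hKT : K = closure (convexHull ℝ (slope '' (T : Set (E × ℤ))))) :
    Filter.Tendsto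
      (fun j : ℕ => (Nat.card {x : E | (x, (j : ℤ)) ∈ T} : ℝ) / (j : ℝ) ^ Module.finrank ℝ E)
      Filter.atTop (nhds (μ.real K / ZLattice.covolume L μ)) := by
  set Q := convexHull ℝ (slope '' (T : Set (E × ℤ))) with hQ
  have hQconv : Convex ℝ Q := convex_convexHull ℝ _
  have hKconv : Convex ℝ K := hKT ▸ hQconv.closure
  have hTK : ∀ z ∈ (T : Set (E × ℤ)), slope z ∈ K := fun z hz =>
    hKT ▸ subset_closure (subset_convexHull ℝ _ ⟨z, hz, rfl⟩)
  obtain ⟨p, hp⟩ := interior_convexHull_slope_nonempty L T hpos hgen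
  rw [tendsto_order]
  constructor
  · intro a ha
    have hθ : ∃ θ : ℝ, 0 < θ ∧ θ < 1 ∧
        a < θ ^ Module.finrank ℝ E * (μ.real K / ZLattice.covolume L μ) := by
      have hc : Filter.Tendsto
          (fun θ : ℝ => θ ^ Module.finrank ℝ E * (μ.real K / ZLattice.covolume L μ))
          (nhdsWithin 1 (Set.Iio 1)) (nhds (μ.real K / ZLattice.covolume L μ)) := by
        have : Continuous
          (fun θ : ℝ => θ ^ Module.finrank ℝ E * (μ.real K / ZLattice.covolume L μ)) := by
          fun_prop
        simpa using (this.tendsto 1).mono_left nhdsWithin_le_nhds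
      have h1 := hc.eventually_const_lt ha
      have h2 : ∀ᶠ θ : ℝ in nhdsWithin 1 (Set.Iio 1), 0 < θ :=
        nhdsWithin_le_nhds (lt_mem_nhds one_pos)
      have h3 : ∀ᶠ θ : ℝ in nhdsWithin 1 (Set.Iio 1), θ < 1 := self_mem_nhdsWithin
      obtain ⟨θ, h⟩ := (h1.and (h2.and h3)).exists
      exact ⟨θ, h.2.1, h.2.2, h.1⟩
    obtain ⟨θ, hθ0, hθ1, hθa⟩ := hθ
    -- Shrinking towards an interior point of the hull puts the closure K inside the interior, at
    -- the cost of a factor θ^dim in volume.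
    set K' := AffineMap.homothety p θ '' K with hK'
    have hK'c : IsCompact K' := hK.image (AffineMap.homothety_continuous p θ)
    have hK'conv : Convex ℝ K' := hKconv.affine_image _
    have hK'Q : K' ⊆ interior Q := by
      rintro _ ⟨x, hx, rfl⟩
      have := hQconv.combo_interior_closure_mem_interior hp (hKT ▸ hx) (sub_pos.2 hθ1) hθ0.le
        (by ring)
      convert! this using 1
      rw [AffineMap.homothety_apply, vsub_eq_sub, vadd_eq_add]
      module
    have hlim := tendsto_card_inter_smul_lattice μ L hK'c hK'conv
    have hvol : μ.real K' = θ ^ Module.finrank ℝ E * μ.real K := by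
      rw [measureReal_def, hK', Measure.addHaar_image_homothety, ENNReal.toReal_mul,
        ENNReal.toReal_ofReal (abs_nonneg _), abs_of_nonneg (pow_nonneg hθ0.le _),
        measureReal_def]
    rw [hvol, mul_div_assoc] at hlim
    filter_upwards [hlim.eventually_const_lt hθa, Filter.eventually_gt_atTop 0,
      eventually_mem_of_subset_interior L T hpos hTL hgen hK'c hK'Q] with j hj hj0 hjT
    refine hj.trans_le (div_le_div_of_nonneg_right ?_ (by positivity))
    obtain ⟨hfin, -⟩ := card_level_le_card_inter_smul_lattice L T hTL hK hTK hj0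
    have hfin' : Finite {x : E | (x, (j : ℤ)) ∈ T} := by
      have hj' : (j : ℝ) ≠ 0 := by exact_mod_cast hj0.ne'
      refine Set.Finite.subset ((Set.finite_coe_iff.1 hfin).image fun x => (j : ℝ) • x) ?_
      intro x hx
      refine ⟨(j : ℝ)⁻¹ • x, ⟨?_, Set.smul_mem_smul_set (hTL _ hx)⟩, smul_inv_smul₀ hj' x⟩
      simpa [slope] using hTK _ hx
    exact_mod_cast card_inter_smul_lattice_le_card_level L T hj0 hfin' hjT
  · intro a ha
    filter_upwards [(tendsto_card_inter_smul_lattice μ L hK hKconv).eventually_lt_const ha,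
      Filter.eventually_gt_atTop 0] with j hj hj0
    refine lt_of_le_of_lt (div_le_div_of_nonneg_right ?_ (by positivity)) hj
    exact_mod_cast (card_level_le_card_inter_smul_lattice L T hTL hK hTK hj0).2

end GradedLatticeCount

/-! ### Linearly bounded semigroups of integral points -/

section BoundedSemigroups

open Submodule

variable {n : ℕ}

@[simp]
theorem toReal_fst_apply (x : (Fin n → ℤ) × ℤ) (c : Fin n) : (toReal n x).1 c = x.1 c := rfl

@[simp]
theorem toReal_snd (x : (Fin n → ℤ) × ℤ) : (toReal n x).2 = x.2 := rfl

theorem toReal_injective : Function.Injective (toReal n) := by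
  intro x y h
  have h1 := congrArg Prod.fst h
  have h2 := congrArg Prod.snd h
  refine Prod.ext (funext fun i => ?_) ?_
  · have : (x.1 i : ℝ) = y.1 i := congrFun h1 i
    exact Int.cast_injective this
  · exact Int.cast_injective (α := ℝ) h2

theorem one_le_norm_toReal {x : (Fin n → ℤ) × ℤ} (hx : x ≠ 0) : 1 ≤ ‖toReal n x‖ := by
  by_cases h2 : x.2 = 0
  · obtain ⟨c, hc⟩ : ∃ c, x.1 c ≠ 0 := by
      by_contra! h
      exact hx (Prod.ext (funext h) h2)
    calc (1 : ℝ) ≤ |(x.1 c : ℝ)| := by exact_mod_cast Int.one_le_abs hc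
      _ = ‖(toReal n x).1 c‖ := rfl
      _ ≤ ‖(toReal n x).1‖ := norm_le_pi_norm _ c
      _ ≤ _ := norm_fst_le _
  · calc (1 : ℝ) ≤ |(x.2 : ℝ)| := by exact_mod_cast Int.one_le_abs h2
      _ ≤ _ := norm_snd_le (toReal n x)

/-- A semigroup contained in a cone `‖x‖ ≤ R t`. -/
def IsLinearlyBounded (S : AddSubsemigroup ((Fin n → ℤ) × ℤ)) : Prop :=
  ∃ R : ℕ, ∀ x ∈ S, 0 ≤ x.2 ∧ ∀ c, |x.1 c| ≤ R * x.2

/-- The cone `‖x‖ ≤ R t` in `ℝⁿ × ℝ`. -/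
def boundingCone (n R : ℕ) : PointedCone ℝ ((Fin n → ℝ) × ℝ) where
  carrier := {y | 0 ≤ y.2 ∧ ∀ c, |y.1 c| ≤ R * y.2}
  zero_mem' := by simp
  add_mem' := by
    rintro x y ⟨hx, hx'⟩ ⟨hy, hy'⟩
    refine ⟨add_nonneg hx hy, fun c => (abs_add_le _ _).trans ?_⟩
    have h := add_le_add (hx' c) (hy' c)
    rwa [← mul_add] at h
  smul_mem' := by
    rintro ⟨r, hr⟩ x ⟨hx, hx'⟩
    refine ⟨mul_nonneg hr hx, fun c => ?_⟩
    change |r * x.1 c| ≤ R * (r * x.2)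
    rw [abs_mul, abs_of_nonneg hr, mul_left_comm]
    exact mul_le_mul_of_nonneg_left (hx' c) hr

variable {S : AddSubsemigroup ((Fin n → ℤ) × ℤ)}

theorem IsLinearlyBounded.exists_cone_subset (hS : IsLinearlyBounded S) :
    ∃ R : ℕ, ∀ y ∈ cone S, 0 ≤ y.2 ∧ ∀ c, |y.1 c| ≤ R * y.2 := by
  obtain ⟨R, hR⟩ := hS
  refine ⟨R, fun y hy => ?_⟩
  have hle : PointedCone.hull ℝ (toReal n '' S) ≤ boundingCone n R := by
    refine span_le.2 ?_
    rintro _ ⟨x, hx, rfl⟩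
    obtain ⟨h1, h2⟩ := hR x hx
    refine ⟨?_, fun c => ?_⟩
    · rw [toReal_snd]
      exact_mod_cast h1
    · rw [toReal_fst_apply, toReal_snd]
      exact_mod_cast h2 c
  have hclosed : IsClosed {y : (Fin n → ℝ) × ℝ | 0 ≤ y.2 ∧ ∀ c, |y.1 c| ≤ R * y.2} := by
    simp only [Set.ofPred_and, Set.ofPred_forall]
    refine (isClosed_le (by fun_prop) (by fun_prop)).inter
      (isClosed_iInter fun c => isClosed_le (by fun_prop) (by fun_prop))
  have hsub : (PointedCone.hull ℝ (toReal n '' S) : Set ((Fin n → ℝ) × ℝ)) ⊆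
      {y | 0 ≤ y.2 ∧ ∀ c, |y.1 c| ≤ R * y.2} := fun z hz => hle hz
  exact closure_minimal hsub hclosed hy

theorem zero_mem_cone (S : AddSubsemigroup ((Fin n → ℤ) × ℤ)) : 0 ∈ cone S :=
  subset_closure (Submodule.zero_mem _)

theorem toReal_mem_cone {s : (Fin n → ℤ) × ℤ} (hs : s ∈ S) : toReal n s ∈ cone S :=
  subset_closure (subset_span ⟨s, hs, rfl⟩)

theorem smul_mem_cone {y : (Fin n → ℝ) × ℝ} (hy : y ∈ cone S) {r : ℝ} (hr : 0 ≤ r) :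
    r • y ∈ cone S :=
  map_mem_closure (continuous_const_smul r) hy fun _ hz =>
    PointedCone.smul_mem _ hr hz

theorem convex_cone (S : AddSubsemigroup ((Fin n → ℤ) × ℤ)) : Convex ℝ (cone S) :=
  (PointedCone.convex _).closure

theorem cone_subset_realSpan (S : AddSubsemigroup ((Fin n → ℤ) × ℤ)) :
    cone S ⊆ realSpan S := by
  refine closure_minimal ?_ (realSpan S).closed_of_finiteDimensional
  exact span_le (p := (realSpan S).restrictScalars {c : ℝ // 0 ≤ c}) |>.2 subset_span

theorem IsLinearlyBounded.eq_zero_of_mem_cone (hS : IsLinearlyBounded S)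
    {y : (Fin n → ℝ) × ℝ} (hy : y ∈ cone S) (h0 : y.2 = 0) : y = 0 := by
  obtain ⟨R, hR⟩ := hS.exists_cone_subset
  refine Prod.ext (funext fun c => ?_) h0
  have := (hR y hy).2 c
  rw [h0, mul_zero] at this
  exact abs_eq_zero.1 (le_antisymm this (abs_nonneg _))

theorem IsLinearlyBounded.eq_zero_of_mem (hS : IsLinearlyBounded S)
    {s : (Fin n → ℤ) × ℤ} (hs : s ∈ S) (h0 : s.2 = 0) : s = 0 := by
  have := hS.eq_zero_of_mem_cone (toReal_mem_cone hs) (by simp [toReal, h0])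
  exact toReal_injective (this.trans (map_zero _).symm)

theorem IsLinearlyBounded.isStronglyNonneg (hS : IsLinearlyBounded S) (hpos : ∃ x ∈ S, x.2 ≠ 0) :
    IsStronglyNonneg S := by
  obtain ⟨R, hR⟩ := hS.exists_cone_subset
  refine ⟨⟨fun x hx => (hS.choose_spec x hx).1, hpos⟩, fun W hW => ?_, ?_⟩
  · rw [Submodule.eq_bot_iff]
    intro w hw
    have h1 := (hR w (hW hw)).1
    have h2 := (hR (-w) (hW (W.neg_mem hw))).1
    rw [Prod.snd_neg] at h2
    exact hS.eq_zero_of_mem_cone (hW hw) (by linarith)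
  · refine Set.Subset.antisymm ?_ ?_
    · rintro y ⟨hy, -, hy0⟩
      exact hS.eq_zero_of_mem_cone hy hy0
    · rintro _ rfl
      exact ⟨zero_mem_cone S, Submodule.zero_mem _⟩

/-- An index of 0 encodes infinite index, so positivity is the finiteness of m. -/
theorem levelIndex_pos_and_exists (hpos : ∃ x ∈ S, x.2 ≠ 0) :
    0 < levelIndex S ∧ (∀ x ∈ group S, (levelIndex S : ℤ) ∣ x.2) ∧
      ∃ g ∈ group S, g.2 = levelIndex S := by
  set H := (group S).map (AddMonoidHom.snd (Fin n → ℤ) ℤ) with hH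
  obtain ⟨a, ha⟩ := Int.subgroup_cyclic H
  rw [← AddSubgroup.zmultiples_eq_closure] at ha
  have hm : levelIndex S = a.natAbs := by
    rw [levelIndex, ← hH, ha, Int.index_zmultiples]
  have hdvd : ∀ x ∈ group S, (levelIndex S : ℤ) ∣ x.2 := by
    intro x hx
    have : x.2 ∈ H := ⟨x, hx, rfl⟩
    rw [ha, Int.mem_zmultiples_iff] at this
    rwa [hm, Int.natAbs_dvd]
  refine ⟨?_, hdvd, ?_⟩
  · obtain ⟨x, hx, hx0⟩ := hpos
    have h := hdvd x (AddSubgroup.subset_closure hx)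
    rcases Nat.eq_zero_or_pos (levelIndex S) with h0 | h0
    · rw [h0] at h
      exact absurd (by simpa using h) hx0
    · exact h0
  · have : (levelIndex S : ℤ) ∈ H := by
      rw [ha, Int.mem_zmultiples_iff, hm]
      exact Int.dvd_natAbs.2 dvd_rfl
    obtain ⟨g, hg, hg'⟩ := this
    exact ⟨g, hg, hg'⟩

theorem newtonOkounkov_nonempty (hS : IsLinearlyBounded S) (hpos : ∃ x ∈ S, x.2 ≠ 0) :
    (newtonOkounkov S).Nonempty := by
  obtain ⟨x, hx, hx0⟩ := hpos
  have hx2 : (0 : ℝ) < x.2 := by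
    exact_mod_cast lt_of_le_of_ne (hS.choose_spec x hx).1 hx0.symm
  refine ⟨((levelIndex S : ℝ) / x.2) • toReal n x, smul_mem_cone (toReal_mem_cone hx)
    (by positivity), ?_⟩
  exact div_mul_cancel₀ _ hx2.ne'

theorem convex_newtonOkounkov (S : AddSubsemigroup ((Fin n → ℤ) × ℤ)) :
    Convex ℝ (newtonOkounkov S) :=
  (convex_cone S).inter (convex_hyperplane (f := fun y : (Fin n → ℝ) × ℝ => y.2)
    (LinearMap.snd ℝ (Fin n → ℝ) ℝ).isLinear _)

theorem IsLinearlyBounded.isCompact_newtonOkounkov (hS : IsLinearlyBounded S) :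
    IsCompact (newtonOkounkov S) := by
  obtain ⟨R, hR⟩ := hS.exists_cone_subset
  refine Metric.isCompact_of_isClosed_isBounded
    (isClosed_closure.inter (isClosed_eq continuous_snd continuous_const)) ?_
  refine (Metric.isBounded_closedBall (x := (0 : (Fin n → ℝ) × ℝ))
    (r := max (R * levelIndex S) (levelIndex S))).subset ?_
  rintro y ⟨hy, hy2⟩
  rw [Set.mem_ofPred_eq] at hy2
  rw [mem_closedBall_zero_iff, Prod.norm_def]
  refine max_le_max ?_ ?_
  · refine (pi_norm_le_iff_of_nonneg (by positivity)).2 fun c => ?_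
    rw [← hy2]
    exact (hR y hy).2 c
  · rw [hy2, Real.norm_eq_abs, Nat.abs_cast]

theorem toReal_mem_realSpan_of_mem_group {x : (Fin n → ℤ) × ℤ} (hx : x ∈ group S) :
    toReal n x ∈ realSpan S := by
  refine (AddSubgroup.closure_le (K := (realSpan S).toAddSubgroup.comap (toReal n))).2 ?_ hx
  exact fun s hs => subset_span ⟨s, hs, rfl⟩

theorem toReal_mem_boundary_of_mem_groupZero {x : (Fin n → ℤ) × ℤ} (hx : x ∈ groupZero S) :
    toReal n x ∈ boundary S := by
  refine ⟨toReal_mem_realSpan_of_mem_group hx.1, ?_⟩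
  have : x.2 = 0 := hx.2
  simp [toReal, this]

/-- If a subspace contains `s - (s_t / m) p` for all `s ∈ S`, then it contains `∂M(S)`. -/
theorem boundary_le_of_forall_sub_mem (V : Submodule ℝ ((Fin n → ℝ) × ℝ))
    (p : (Fin n → ℝ) × ℝ)
    (h : ∀ s ∈ S, toReal n s - ((s.2 : ℝ) / levelIndex S) • p ∈ V) : boundary S ≤ V := by
  rintro y ⟨hy, hy0⟩
  have hle : realSpan S ≤ V.comap (LinearMap.id -
      (LinearMap.toSpanSingleton ℝ _ p).comp
        ((levelIndex S : ℝ)⁻¹ • LinearMap.snd ℝ (Fin n → ℝ) ℝ)) := by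
    refine span_le.2 ?_
    rintro _ ⟨s, hs, rfl⟩
    have := h s hs
    rw [div_eq_inv_mul, ← toReal_snd] at this
    simpa only [Submodule.comap_coe, Set.mem_preimage, SetLike.mem_coe, LinearMap.sub_apply,
      LinearMap.id_apply, LinearMap.comp_apply, LinearMap.smul_apply, LinearMap.snd_apply,
      LinearMap.toSpanSingleton_apply, smul_eq_mul] using this
  have hy0' : y.2 = 0 := hy0
  simpa [hy0'] using hle hy

/-- Every s in S at positive level rescales to a point of Δ(S), so differences with a fixed point of
Δ(S) span ∂M(S). A level 0 element is 0 by the linear bound. -/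
theorem vectorSpan_newtonOkounkov (hS : IsLinearlyBounded S) (hpos : ∃ x ∈ S, x.2 ≠ 0) :
    vectorSpan ℝ (newtonOkounkov S) = boundary S := by
  have hm := (levelIndex_pos_and_exists hpos).1
  have hm' : (levelIndex S : ℝ) ≠ 0 := by exact_mod_cast hm.ne'
  refine le_antisymm ?_ ?_
  · rw [vectorSpan_def, span_le]
    rintro _ ⟨x, ⟨hx, hx2⟩, y, ⟨hy, hy2⟩, rfl⟩
    refine ⟨(realSpan S).sub_mem (cone_subset_realSpan S hx) (cone_subset_realSpan S hy), ?_⟩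
    have hx2' : x.2 = levelIndex S := hx2
    have hy2' : y.2 = levelIndex S := hy2
    simp [hx2', hy2']
  · obtain ⟨p, hp⟩ := newtonOkounkov_nonempty hS hpos
    refine boundary_le_of_forall_sub_mem _ p fun s hs => ?_
    by_cases h0 : s.2 = 0
    · rw [hS.eq_zero_of_mem hs h0]
      simp
    have hs2 : (0 : ℝ) < s.2 := by
      exact_mod_cast lt_of_le_of_ne (hS.choose_spec s hs).1 (Ne.symm h0)
    have hq : ((levelIndex S : ℝ) / s.2) • toReal n s ∈ newtonOkounkov S :=
      ⟨smul_mem_cone (toReal_mem_cone hs) (by positivity), div_mul_cancel₀ _ hs2.ne'⟩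
    have := (vectorSpan ℝ (newtonOkounkov S)).smul_mem ((s.2 : ℝ) / levelIndex S)
      (vsub_mem_vectorSpan ℝ hq hp)
    rw [vsub_eq_sub, smul_sub, smul_smul] at this
    rwa [show (s.2 : ℝ) / levelIndex S * (levelIndex S / s.2) = 1 by field_simp, one_smul] at this

/-- The lattice of differences of elements of `S` at level `0`, in a subspace. -/
def differenceLattice (S : AddSubsemigroup ((Fin n → ℤ) × ℤ))
    (W : Submodule ℝ ((Fin n → ℝ) × ℝ)) : Submodule ℤ W :=
  AddSubgroup.toIntSubmodule (((groupZero S).map (toReal n)).comap W.subtype.toAddMonoidHom)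

theorem mem_differenceLattice {W : Submodule ℝ ((Fin n → ℝ) × ℝ)} {w : W} :
    w ∈ differenceLattice S W ↔ ∃ x ∈ groupZero S, toReal n x = w := Iff.rfl

theorem mem_integralPoints {W : Submodule ℝ ((Fin n → ℝ) × ℝ)} {w : W} :
    w ∈ integralPoints W ↔ ∃ x, toReal n x = w := Iff.rfl

theorem differenceLattice_le_integralPoints (W : Submodule ℝ ((Fin n → ℝ) × ℝ)) :
    differenceLattice S W ≤ integralPoints W := by
  intro w hw
  obtain ⟨x, -, hx⟩ := mem_differenceLattice.1 hw
  exact mem_integralPoints.2 ⟨x, hx⟩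

instance discreteTopology_integralPoints (W : Submodule ℝ ((Fin n → ℝ) × ℝ)) :
    DiscreteTopology (integralPoints W) := by
  refine DiscreteTopology.of_forall_le_dist one_pos fun x y hxy => ?_
  obtain ⟨a, ha⟩ := mem_integralPoints.1 x.2
  obtain ⟨b, hb⟩ := mem_integralPoints.1 y.2
  have hab : a - b ≠ 0 := by
    intro h
    rw [sub_eq_zero] at h
    refine hxy (Subtype.ext (Subtype.ext ?_))
    rw [← ha, ← hb, h]
  have := one_le_norm_toReal hab
  rw [map_sub, ha, hb, ← dist_eq_norm] at this
  exact this

instance discreteTopology_differenceLattice (W : Submodule ℝ ((Fin n → ℝ) × ℝ)) :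
    DiscreteTopology (differenceLattice S W) :=
  DiscreteTopology.of_subset (s := (integralPoints W : Set W))
    (discreteTopology_integralPoints W)
    (differenceLattice_le_integralPoints W)

theorem span_differenceLattice (hpos : ∃ x ∈ S, x.2 ≠ 0) {W : Submodule ℝ ((Fin n → ℝ) × ℝ)}
    (hW : W = boundary S) : span ℝ (differenceLattice S W : Set W) = ⊤ := by
  obtain ⟨hm, hdvd, g, hg, hgm⟩ := levelIndex_pos_and_exists hpos
  have hm' : (levelIndex S : ℝ) ≠ 0 := by exact_mod_cast hm.ne'
  rw [← (Submodule.map_injective_of_injective W.injective_subtype).eq_iff, Submodule.map_span,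
    Submodule.map_top, Submodule.range_subtype]
  refine le_antisymm ?_ ?_
  · rw [span_le]
    rintro _ ⟨w, -, rfl⟩
    exact w.2
  · conv_lhs => rw [hW]
    refine boundary_le_of_forall_sub_mem _ (toReal n g) fun s hs => ?_
    obtain ⟨l, hl⟩ := hdvd s (AddSubgroup.subset_closure hs)
    have hmem : s - l • g ∈ groupZero S := by
      refine ⟨(group S).sub_mem (AddSubgroup.subset_closure hs) ((group S).zsmul_mem hg l), ?_⟩
      change s.2 - l * g.2 = 0
      rw [hl, hgm]
      ring
    have hW' : toReal n (s - l • g) ∈ W := hW ▸ toReal_mem_boundary_of_mem_groupZero hmem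
    refine subset_span ⟨⟨_, hW'⟩, mem_differenceLattice.2 ⟨_, hmem, rfl⟩, ?_⟩
    change toReal n (s - l • g) = _
    rw [map_sub, map_zsmul, hl, Int.cast_mul, Int.cast_natCast,
      mul_div_cancel_left₀ _ hm', Int.cast_smul_eq_zsmul]

theorem isZLattice_differenceLattice (hpos : ∃ x ∈ S, x.2 ≠ 0)
    {W : Submodule ℝ ((Fin n → ℝ) × ℝ)} (hW : W = boundary S) :
    IsZLattice ℝ (differenceLattice S W) :=
  ⟨span_differenceLattice hpos hW⟩

theorem isZLattice_integralPoints (hpos : ∃ x ∈ S, x.2 ≠ 0)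
    {W : Submodule ℝ ((Fin n → ℝ) × ℝ)} (hW : W = boundary S) :
    IsZLattice ℝ (integralPoints W) :=
  ⟨top_le_iff.1 ((span_differenceLattice hpos hW).ge.trans
    (span_mono (differenceLattice_le_integralPoints W)))⟩

theorem relIndex_differenceLattice {W : Submodule ℝ ((Fin n → ℝ) × ℝ)} (hW : W = boundary S) :
    (differenceLattice S W).toAddSubgroup.relIndex (integralPoints W).toAddSubgroup =
      boundaryIndex S := by
  change (((groupZero S).map (toReal n)).comap W.subtype.toAddMonoidHom).relIndex
    (((toReal n).range).comap W.subtype.toAddMonoidHom) = _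
  rw [AddSubgroup.relIndex_comap, boundaryIndex,
    ← AddSubgroup.relIndex_map_map_of_injective _ _ (toReal_injective (n := n))]
  congr 1
  ext y
  constructor
  · rintro ⟨w, ⟨x, hx⟩, rfl⟩
    refine ⟨x, ?_, hx⟩
    change toReal n x ∈ boundary S
    rw [hx, ← hW]
    exact w.2
  · rintro ⟨x, hx, rfl⟩
    have : toReal n x ∈ W := hW ▸ hx
    exact ⟨⟨_, this⟩, ⟨x, rfl⟩, rfl⟩

end BoundedSemigroups

/-! ### Translation of the levels m l into W -/

section SliceSemigroup

open Submodule

variable {n : ℕ} {S : AddSubsemigroup ((Fin n → ℤ) × ℤ)}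

/-- The elements of `S` at positive levels `m l`, translated into `W` by `-l g`. -/
def sliceSemigroup (S : AddSubsemigroup ((Fin n → ℤ) × ℤ)) (W : Submodule ℝ ((Fin n → ℝ) × ℝ))
    (g : (Fin n → ℤ) × ℤ) : AddSubsemigroup (W × ℤ) where
  carrier := {z | 0 < z.2 ∧ ∃ s ∈ S, s.2 = levelIndex S * z.2 ∧ toReal n (s - z.2 • g) = z.1}
  add_mem' := by
    rintro x y ⟨hx, s, hs, hs2, hs1⟩ ⟨hy, t, ht, ht2, ht1⟩
    refine ⟨add_pos hx hy, s + t, S.add_mem hs ht, ?_, ?_⟩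
    · rw [Prod.snd_add, Prod.snd_add, hs2, ht2, mul_add]
    · rw [Prod.snd_add, Prod.fst_add, Submodule.coe_add, ← hs1, ← ht1, ← map_add]
      congr 1
      module

theorem sub_zsmul_mem_groupZero {g : (Fin n → ℤ) × ℤ} (hg : g ∈ group S)
    (hgm : g.2 = levelIndex S) {x : (Fin n → ℤ) × ℤ} (hx : x ∈ group S) {l : ℤ}
    (hl : x.2 = levelIndex S * l) : x - l • g ∈ groupZero S := by
  refine ⟨(group S).sub_mem hx ((group S).zsmul_mem hg l), ?_⟩
  change x.2 - l * g.2 = 0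
  rw [hl, hgm]
  ring

variable {W : Submodule ℝ ((Fin n → ℝ) × ℝ)} {g : (Fin n → ℤ) × ℤ}

theorem fst_mem_differenceLattice_of_mem_slice (hg : g ∈ group S) (hgm : g.2 = levelIndex S)
    {z : W × ℤ} (hz : z ∈ sliceSemigroup S W g) : z.1 ∈ differenceLattice S W := by
  obtain ⟨-, s, hs, hs2, hs1⟩ := hz
  exact mem_differenceLattice.2
    ⟨_, sub_zsmul_mem_groupZero hg hgm (AddSubgroup.subset_closure hs) hs2, hs1⟩

theorem mk_mem_sliceSemigroup (hW : W = boundary S) (hg : g ∈ group S) (hgm : g.2 = levelIndex S)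
    {s : (Fin n → ℤ) × ℤ} (hs : s ∈ S) {l : ℤ} (hl : s.2 = levelIndex S * l) (hl0 : 0 < l) :
    ∃ w : W, toReal n (s - l • g) = w ∧ (w, l) ∈ sliceSemigroup S W g := by
  have := toReal_mem_boundary_of_mem_groupZero
    (sub_zsmul_mem_groupZero hg hgm (AddSubgroup.subset_closure hs) hl)
  rw [← hW] at this
  exact ⟨⟨_, this⟩, rfl, hl0, s, hs, hl, rfl⟩

theorem IsLinearlyBounded.eq_zero_or_exists_mem_slice (hS : IsLinearlyBounded S)
    (hpos : ∃ x ∈ S, x.2 ≠ 0) (hW : W = boundary S) (hg : g ∈ group S) (hgm : g.2 = levelIndex S)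
    {s : (Fin n → ℤ) × ℤ} (hs : s ∈ S) :
    s = 0 ∨ ∃ (l : ℤ) (w : W), s.2 = levelIndex S * l ∧ toReal n (s - l • g) = w ∧
      (w, l) ∈ sliceSemigroup S W g := by
  obtain ⟨hm, hdvd, -⟩ := levelIndex_pos_and_exists hpos
  obtain ⟨l, hl⟩ := hdvd s (AddSubgroup.subset_closure hs)
  by_cases h0 : s.2 = 0
  · exact Or.inl (hS.eq_zero_of_mem hs h0)
  have hs2 : 0 < s.2 := lt_of_le_of_ne (hS.choose_spec s hs).1 (Ne.symm h0)
  have hl0 : 0 < l := by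
    rw [hl] at hs2
    exact pos_of_mul_pos_right hs2 (by positivity)
  obtain ⟨w, hw, hwl⟩ := mk_mem_sliceSemigroup hW hg hgm hs hl hl0
  exact Or.inr ⟨l, w, hl, hw, hwl⟩

/-- The translation x ↦ (x - l g, l) is additive, so it carries all of G(S) into the group generated
by the slice. A pair z comes from h + z.2 g, with h in G_0(S) representing z.1. -/
theorem IsLinearlyBounded.mem_span_sliceSemigroup (hS : IsLinearlyBounded S)
    (hpos : ∃ x ∈ S, x.2 ≠ 0) (hW : W = boundary S) (hg : g ∈ group S) (hgm : g.2 = levelIndex S)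
    {z : W × ℤ} (hz : z.1 ∈ differenceLattice S W) :
    z ∈ span ℤ (sliceSemigroup S W g : Set (W × ℤ)) := by
  obtain ⟨hm, -⟩ := levelIndex_pos_and_exists hpos
  have key : ∀ x ∈ group S, ∃ (l : ℤ) (w : W), x.2 = levelIndex S * l ∧
      toReal n (x - l • g) = w ∧ (w, l) ∈ span ℤ (sliceSemigroup S W g : Set (W × ℤ)) := by
    intro x hx
    induction hx using AddSubgroup.closure_induction with
    | mem s hs =>
      rcases hS.eq_zero_or_exists_mem_slice hpos hW hg hgm hs with h | ⟨l, w, h1, h2, h3⟩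
      · exact ⟨0, 0, by simp [h], by simp [h], Submodule.zero_mem _⟩
      · exact ⟨l, w, h1, h2, subset_span h3⟩
    | zero => exact ⟨0, 0, by simp, by simp, Submodule.zero_mem _⟩
    | add x y _ _ hx hy =>
      obtain ⟨l, w, h1, h2, h3⟩ := hx
      obtain ⟨l', w', h1', h2', h3'⟩ := hy
      refine ⟨l + l', w + w', by rw [Prod.snd_add, h1, h1', mul_add], ?_,
        Submodule.add_mem _ h3 h3'⟩
      rw [Submodule.coe_add, ← h2, ← h2', ← map_add]
      congr 1
      module
    | neg x _ hx =>
      obtain ⟨l, w, h1, h2, h3⟩ := hx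
      refine ⟨-l, -w, by rw [Prod.snd_neg, h1, mul_neg], ?_, Submodule.neg_mem _ h3⟩
      rw [Submodule.coe_neg, ← h2, ← map_neg]
      congr 1
      module
  obtain ⟨h, hh, hhz⟩ := mem_differenceLattice.1 hz
  obtain ⟨l, w, h1, h2, h3⟩ := key (h + z.2 • g)
    ((group S).add_mem hh.1 ((group S).zsmul_mem hg _))
  have hh2 : h.2 = 0 := hh.2
  have hl : l = z.2 := by
    rw [Prod.snd_add, hh2, zero_add, Prod.smul_snd, hgm, smul_eq_mul, mul_comm] at h1
    exact (mul_left_cancel₀ (by exact_mod_cast hm.ne') h1).symm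
  subst hl
  rw [add_sub_cancel_right, hhz] at h2
  rwa [show z = (w, z.2) from Prod.ext (Subtype.ext h2) rfl]

/-- The section of the cone of `S` at level `m`, translated into `W` by `-g`. -/
def sliceBody (S : AddSubsemigroup ((Fin n → ℤ) × ℤ)) (W : Submodule ℝ ((Fin n → ℝ) × ℝ))
    (g : (Fin n → ℤ) × ℤ) : Set W :=
  {w | (w : (Fin n → ℝ) × ℝ) + toReal n g ∈ newtonOkounkov S}

theorem IsLinearlyBounded.isCompact_sliceBody (hS : IsLinearlyBounded S) :
    IsCompact (sliceBody S W g) := by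
  have h := hS.isCompact_newtonOkounkov
  have hemb : Topology.IsClosedEmbedding
      fun w : W => (w : (Fin n → ℝ) × ℝ) + toReal n g :=
    (Homeomorph.addRight (toReal n g)).isClosedEmbedding.comp
      W.closed_of_finiteDimensional.isClosedEmbedding_subtypeVal
  exact hemb.isCompact_preimage h

theorem convex_sliceBody : Convex ℝ (sliceBody S W g) := by
  intro x hx y hy a b ha hb hab
  have := convex_newtonOkounkov S hx hy ha hb hab
  change ((a • x + b • y : W) : (Fin n → ℝ) × ℝ) + toReal n g ∈ newtonOkounkov S
  convert! this using 1
  simp only [Submodule.coe_add, Submodule.coe_smul, smul_add]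
  rw [add_add_add_comm, ← add_smul, hab, one_smul]

theorem slope_mem_sliceBody {z : W × ℤ}
    (hz : z ∈ sliceSemigroup S W g) : slope z ∈ sliceBody S W g := by
  obtain ⟨hz2, s, hs, hs2, hs1⟩ := hz
  have hz2' : (0 : ℝ) < z.2 := by exact_mod_cast hz2
  have h : ((slope z : W) : (Fin n → ℝ) × ℝ) + toReal n g = (z.2 : ℝ)⁻¹ • toReal n s := by
    rw [slope, Submodule.coe_smul, ← hs1, map_sub, map_zsmul, smul_sub,
      ← Int.cast_smul_eq_zsmul ℝ, inv_smul_smul₀ hz2'.ne', sub_add_cancel]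
  change ((slope z : W) : (Fin n → ℝ) × ℝ) + toReal n g ∈ newtonOkounkov S
  rw [h]
  refine ⟨smul_mem_cone (toReal_mem_cone hs) (by positivity), ?_⟩
  change (z.2 : ℝ)⁻¹ * (toReal n s).2 = levelIndex S
  rw [toReal_snd, hs2]
  push_cast
  field_simp

theorem IsLinearlyBounded.eq_zero_or_exists_convexHull (hS : IsLinearlyBounded S)
    (hpos : ∃ x ∈ S, x.2 ≠ 0) (hW : W = boundary S) (hg : g ∈ group S) (hgm : g.2 = levelIndex S)
    {c : (Fin n → ℝ) × ℝ} (hc : c ∈ PointedCone.hull ℝ (toReal n '' S)) :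
    c = 0 ∨ ∃ r : ℝ, 0 < r ∧
      ∃ q ∈ convexHull ℝ (slope '' (sliceSemigroup S W g : Set (W × ℤ))),
        c = r • ((q : (Fin n → ℝ) × ℝ) + toReal n g) := by
  induction hc using Submodule.span_induction with
  | mem y hy =>
    obtain ⟨s, hs, rfl⟩ := hy
    rcases hS.eq_zero_or_exists_mem_slice hpos hW hg hgm hs with h | ⟨l, w, h1, h2, h3⟩
    · exact Or.inl (by rw [h, map_zero])
    · have hl : (0 : ℝ) < l := by exact_mod_cast h3.1
      refine Or.inr ⟨l, hl, slope (w, l), subset_convexHull ℝ _ ⟨_, h3, rfl⟩, ?_⟩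
      rw [slope, Submodule.coe_smul, smul_add, smul_inv_smul₀ hl.ne', ← h2, map_sub, map_zsmul,
        Int.cast_smul_eq_zsmul, sub_add_cancel]
  | zero => exact Or.inl rfl
  | add x y _ _ hx hy =>
    rcases hx with rfl | ⟨r, hr, q, hq, rfl⟩
    · simpa using hy
    rcases hy with rfl | ⟨r', hr', q', hq', rfl⟩
    · exact Or.inr ⟨r, hr, q, hq, by simp⟩
    have hrr : 0 < r + r' := add_pos hr hr'
    refine Or.inr ⟨r + r', hrr, (r / (r + r')) • q + (r' / (r + r')) • q',
      convex_convexHull ℝ _ hq hq' (by positivity) (by positivity) (by field_simp), ?_⟩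
    simp only [Submodule.coe_add, Submodule.coe_smul, smul_add, smul_smul, add_smul,
      mul_div_cancel₀ _ hrr.ne']
    abel
  | smul a x _ hx =>
    rcases hx with rfl | ⟨r, hr, q, hq, rfl⟩
    · exact Or.inl (smul_zero a)
    rcases a.2.eq_or_lt with h | h
    · left
      have : a = 0 := Subtype.ext h.symm
      rw [this, zero_smul]
    · exact Or.inr ⟨a * r, mul_pos h hr, q, hq, smul_smul (a : ℝ) r _⟩

/-- Central projection to level m sends the non-zero points of the unclosed cone to the hull of the
slopes. It is continuous at positive levels, so it also carries limits to limits. -/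
theorem IsLinearlyBounded.sliceBody_eq_closure (hS : IsLinearlyBounded S)
    (hpos : ∃ x ∈ S, x.2 ≠ 0) (hW : W = boundary S) (hg : g ∈ group S)
    (hgm : g.2 = levelIndex S) :
    sliceBody S W g = closure (convexHull ℝ (slope '' (sliceSemigroup S W g : Set (W × ℤ)))) := by
  obtain ⟨hm, -⟩ := levelIndex_pos_and_exists hpos
  have hm' : (0 : ℝ) < levelIndex S := by exact_mod_cast hm
  refine Set.Subset.antisymm ?_ ?_
  · intro w hw
    set Q := convexHull ℝ (slope '' (sliceSemigroup S W g : Set (W × ℤ))) with hQ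
    rw [Topology.IsInducing.subtypeVal.closure_eq_preimage_closure_image Q, Set.mem_preimage]
    set y := (w : (Fin n → ℝ) × ℝ) + toReal n g with hy
    have hy2 : y.2 = levelIndex S := hw.2
    set φ : (Fin n → ℝ) × ℝ → (Fin n → ℝ) × ℝ :=
      fun c => ((levelIndex S : ℝ) / c.2) • c - toReal n g with hφ
    have hφy : φ y = w := by
      simp only [hφ, hy2, div_self hm'.ne', one_smul]
      rw [hy, add_sub_cancel_right]
    have hφc : ContinuousAt φ y := by
      have h2 : ContinuousAt (fun c : (Fin n → ℝ) × ℝ => (levelIndex S : ℝ) / c.2) y :=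
        continuousAt_const.div continuousAt_snd (by rw [hy2]; exact hm'.ne')
      exact (h2.smul continuousAt_id).sub continuousAt_const
    -- Restricting to positive levels keeps y in the closure and excludes the apex, where the
    -- projection is undefined.
    have hycl : y ∈ closure ({c : (Fin n → ℝ) × ℝ | 0 < c.2} ∩
        (PointedCone.hull ℝ (toReal n '' S) : Set _)) :=
      (isOpen_lt continuous_const continuous_snd).inter_closure
        ⟨by rw [Set.mem_ofPred_eq, hy2]; exact hm', hw.1⟩
    rw [← hφy]
    refine hφc.continuousWithinAt.mem_closure hycl ?_
    rintro c ⟨hc2, hc⟩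
    rcases hS.eq_zero_or_exists_convexHull hpos hW hg hgm hc with rfl | ⟨r, hr, q, hq, rfl⟩
    · exact absurd (show (0 : ℝ) < 0 from hc2) (lt_irrefl _)
    refine ⟨q, hq, ?_⟩
    have hq2 : (q : (Fin n → ℝ) × ℝ).2 = 0 := by
      have : (q : (Fin n → ℝ) × ℝ) ∈ boundary S := hW ▸ q.2
      exact this.2
    have h2 : (r • ((q : (Fin n → ℝ) × ℝ) + toReal n g)).2 = r * levelIndex S := by
      rw [Prod.smul_snd, Prod.snd_add, hq2, zero_add, toReal_snd, hgm, smul_eq_mul,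
        Int.cast_natCast]
    simp only [hφ]
    rw [h2, smul_smul, show (levelIndex S : ℝ) / (r * levelIndex S) * r = 1 by field_simp,
      one_smul, add_sub_cancel_right]
  · refine closure_minimal (convexHull_min ?_ convex_sliceBody) hS.isCompact_sliceBody.isClosed
    rintro _ ⟨z, hz, rfl⟩
    exact slope_mem_sliceBody hz

theorem card_slice_eq_ncard (hW : W = boundary S) (hg : g ∈ group S)
    (hgm : g.2 = levelIndex S) {j : ℕ} (hj : 0 < j) :
    Nat.card {w : W | (w, (j : ℤ)) ∈ sliceSemigroup S W g} =
      {y : Fin n → ℤ | (y, ((levelIndex S * j : ℕ) : ℤ)) ∈ S}.ncard := by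
  rw [← Nat.card_coe_set_eq]
  have h : ∀ y : {y : Fin n → ℤ | (y, ((levelIndex S * j : ℕ) : ℤ)) ∈ S},
      ∃ w : W, toReal n ((y.1, ((levelIndex S * j : ℕ) : ℤ)) - (j : ℤ) • g) = w ∧
        (w, (j : ℤ)) ∈ sliceSemigroup S W g :=
    fun y => mk_mem_sliceSemigroup hW hg hgm y.2 (by push_cast; rfl) (by exact_mod_cast hj)
  choose φ hφ hφT using h
  refine (Nat.card_eq_of_bijective (fun y => ⟨φ y, hφT y⟩) ⟨fun y y' hyy => ?_, ?_⟩).symm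
  · have h1 : φ y = φ y' := congrArg Subtype.val hyy
    have h2 := hφ y
    rw [h1, ← hφ y'] at h2
    have h3 := sub_left_injective (toReal_injective h2)
    exact Subtype.ext (congrArg Prod.fst h3)
  · rintro ⟨w, -, s, hs, hs2, hs1⟩
    have hs' : s = (s.1, ((levelIndex S * j : ℕ) : ℤ)) := by
      ext1
      · rfl
      · rw [hs2]; push_cast; rfl
    refine ⟨⟨s.1, by rw [Set.mem_ofPred_eq, ← hs']; exact hs⟩, ?_⟩
    refine Subtype.ext (Subtype.ext ?_)
    rw [← hφ, ← hs1, ← hs']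

open Classical in
-- The base point chosen in Δ may be replaced by g, which need not lie in Δ but lies in its affine
-- hull; the measure is translation invariant.
theorem integralVolume_newtonOkounkov (hS : IsLinearlyBounded S) (hpos : ∃ x ∈ S, x.2 ≠ 0)
    (hgm : g.2 = levelIndex S) (hg : g ∈ group S) :
    integralVolume (newtonOkounkov S) =
      (Measure.addHaar : Measure (vectorSpan ℝ (newtonOkounkov S))).real
        (sliceBody S (vectorSpan ℝ (newtonOkounkov S)) g) /
      ZLattice.covolume (integralPoints (vectorSpan ℝ (newtonOkounkov S))) Measure.addHaar := by
  have hne := newtonOkounkov_nonempty hS hpos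
  rw [integralVolume, dif_pos hne]
  congr 1
  have hd : hne.some - toReal n g ∈ vectorSpan ℝ (newtonOkounkov S) := by
    rw [vectorSpan_newtonOkounkov hS hpos]
    refine ⟨(realSpan S).sub_mem (cone_subset_realSpan S hne.some_mem.1)
      (toReal_mem_realSpan_of_mem_group hg), ?_⟩
    have h2 : hne.some.2 = levelIndex S := hne.some_mem.2
    simp [h2, hgm]
  have hpre : {w : vectorSpan ℝ (newtonOkounkov S) |
      (w : (Fin n → ℝ) × ℝ) + hne.some ∈ newtonOkounkov S} =
      (fun w => w + ⟨_, hd⟩) ⁻¹' sliceBody S (vectorSpan ℝ (newtonOkounkov S)) g := by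
    ext w
    simp only [Set.mem_ofPred_eq, Set.mem_preimage, sliceBody, Submodule.coe_add]
    rw [add_assoc, sub_add_cancel]
  rw [hpre, measureReal_def, measureReal_def, measure_preimage_add_right]

theorem IsLinearlyBounded.tendsto_ncard_level (hS : IsLinearlyBounded S)
    (hpos : ∃ x ∈ S, x.2 ≠ 0) :
    0 < boundaryIndex S ∧ 0 < integralVolume (newtonOkounkov S) ∧
    Filter.Tendsto
      (fun j : ℕ => ({y : Fin n → ℤ | (y, ((levelIndex S * j : ℕ) : ℤ)) ∈ S}.ncard : ℝ) /
        (j : ℝ) ^ convexDim (newtonOkounkov S))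
      Filter.atTop (nhds (integralVolume (newtonOkounkov S) / boundaryIndex S)) := by
  obtain ⟨hm, -, g, hg, hgm⟩ := levelIndex_pos_and_exists hpos
  have hW := vectorSpan_newtonOkounkov hS hpos
  rw [integralVolume_newtonOkounkov hS hpos hgm hg, convexDim]
  set W := vectorSpan ℝ (newtonOkounkov S)
  set μ : Measure W := Measure.addHaar
  have := isZLattice_differenceLattice hpos hW
  have := isZLattice_integralPoints hpos hW
  have hTpos : ∀ z ∈ sliceSemigroup S W g, 0 < z.2 := fun z hz => hz.1
  have hTL : ∀ z ∈ sliceSemigroup S W g, z.1 ∈ differenceLattice S W := fun z hz =>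
    fst_mem_differenceLattice_of_mem_slice hg hgm hz
  have hgen : ∀ z : W × ℤ, z.1 ∈ differenceLattice S W →
      z ∈ span ℤ (sliceSemigroup S W g : Set (W × ℤ)) := fun z hz =>
    hS.mem_span_sliceSemigroup hpos hW hg hgm hz
  have hcov := covolume_div_covolume_eq_relIndex μ (differenceLattice S W) (integralPoints W)
    (differenceLattice_le_integralPoints W)
  rw [relIndex_differenceLattice hW] at hcov
  have hc1 := ZLattice.covolume_pos (differenceLattice S W) μ
  have hc2 := ZLattice.covolume_pos (integralPoints W) μ
  -- As a quotient of two positive covolumes the index is non-zero, which means finite.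
  have hind : (0 : ℝ) < boundaryIndex S := by
    rw [← hcov]
    exact div_pos hc1 hc2
  have hcl := hS.sliceBody_eq_closure hpos hW hg hgm
  have hint : (interior (sliceBody S W g)).Nonempty := by
    refine (interior_convexHull_slope_nonempty (differenceLattice S W) (sliceSemigroup S W g)
      hTpos hgen).mono ?_
    rw [hcl]
    exact interior_mono subset_closure
  have hvol : 0 < μ.real (sliceBody S W g) :=
    ENNReal.toReal_pos (Measure.measure_pos_of_nonempty_interior μ hint).ne'
      hS.isCompact_sliceBody.measure_lt_top.ne
  refine ⟨by exact_mod_cast hind, div_pos hvol hc2, ?_⟩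
  have hlim := tendsto_card_level_div_pow μ (differenceLattice S W) (sliceSemigroup S W g)
    hTpos hTL hgen hS.isCompact_sliceBody hcl
  have hval : μ.real (sliceBody S W g) / ZLattice.covolume (integralPoints W) μ /
      boundaryIndex S = μ.real (sliceBody S W g) / ZLattice.covolume (differenceLattice S W) μ := by
    rw [← hcov]
    field_simp
  rw [hval]
  refine hlim.congr' ?_
  filter_upwards [Filter.eventually_gt_atTop 0] with j hj
  rw [card_slice_eq_ncard hW hg hgm hj]

end SliceSemigroup

end NewtonOkounkov

end

/-! ### Application to the value semigroup of A -/

theorem mainTheorem4 {k F : Type*} [Field k] [Field F] [Algebra k F] (n : ℕ)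
    (hn : Algebra.trdeg k F = (n : Cardinal))
    (v : NewtonOkounkov.LatticeValuation k F n)
    (hv_faithful : v.Faithful) (hv_leaves : v.HasOneDimLeaves)
    (A : Subalgebra k (Polynomial F))
    (hA : NewtonOkounkov.IsAlmostIntegralType A)
    (hA_pos : ∃ i : ℕ, 0 < i ∧ NewtonOkounkov.homogeneousComponent A i ≠ ⊥) :
    -- the value semigroup is strongly non-negative
    NewtonOkounkov.IsStronglyNonneg (v.valueSemigroup A) ∧
    -- the Newton-Okounkov set is a (non-empty) convex body
    (Convex ℝ (NewtonOkounkov.newtonOkounkov (v.valueSemigroup A)) ∧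
      IsCompact (NewtonOkounkov.newtonOkounkov (v.valueSemigroup A)) ∧
      (NewtonOkounkov.newtonOkounkov (v.valueSemigroup A)).Nonempty) ∧
    -- the two indices are finite, and the Hilbert function takes finite values
    0 < NewtonOkounkov.levelIndex (v.valueSemigroup A) ∧
    0 < NewtonOkounkov.boundaryIndex (v.valueSemigroup A) ∧
    (∀ i : ℕ, NewtonOkounkov.hilbertFunction A i ≠ ⊤) ∧
    -- polynomial growth of degree `dim Δ(A)`
    0 < NewtonOkounkov.integralVolume (NewtonOkounkov.newtonOkounkov (v.valueSemigroup A)) ∧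
    Filter.Tendsto
      (fun j : ℕ =>
        ((NewtonOkounkov.hilbertFunction A
            (NewtonOkounkov.levelIndex (v.valueSemigroup A) * j)).toNat : ℝ) /
          (j : ℝ) ^ NewtonOkounkov.convexDim
            (NewtonOkounkov.newtonOkounkov (v.valueSemigroup A)))
      Filter.atTop
      (nhds (NewtonOkounkov.integralVolume
          (NewtonOkounkov.newtonOkounkov (v.valueSemigroup A)) /
        (NewtonOkounkov.boundaryIndex (v.valueSemigroup A) : ℝ))) := by
  obtain ⟨R, hR⟩ :=
    NewtonOkounkov.exists_abs_apply_le_of_mem_valueSemigroup hn hv_faithful hA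
  have hS : NewtonOkounkov.IsLinearlyBounded (v.valueSemigroup A) := ⟨R, hR⟩
  have hpos : ∃ x ∈ v.valueSemigroup A, x.2 ≠ 0 := by
    obtain ⟨i, hi, hAi⟩ := hA_pos
    obtain ⟨P, ⟨hPA, a, rfl⟩, hP0⟩ := Submodule.exists_mem_ne_zero_of_ne_bot hAi
    have ha : a ≠ 0 := fun h => hP0 (by rw [h, map_zero])
    exact ⟨(v.toFun a, i), (NewtonOkounkov.mem_valueSemigroup_iff v hA.1).2
      ⟨i, rfl, a, ⟨hPA, ha⟩, rfl⟩, Int.natCast_ne_zero.2 hi.ne'⟩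
  have hH := NewtonOkounkov.hilbertFunction_eq_ncard hv_leaves hA.1 fun x hx => (hR x hx).2
  obtain ⟨hind, hvol, hlim⟩ := hS.tendsto_ncard_level hpos
  refine ⟨hS.isStronglyNonneg hpos, ⟨NewtonOkounkov.convex_newtonOkounkov _,
    hS.isCompact_newtonOkounkov, NewtonOkounkov.newtonOkounkov_nonempty hS hpos⟩,
    (NewtonOkounkov.levelIndex_pos_and_exists hpos).1, hind,
    fun i => hH i ▸ ENat.natCast_ne_top _, hvol, ?_⟩
  simp only [hH, ENat.toNat_natCast]
  exact hlim
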